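/- Fix an integer $k\ge 0$ and let $\mathbb A^{[k]}=\mathbb R[\varepsilon]/\langle\varepsilon^{k+1}\rangle$, a graded algebra with $\deg\varepsilon^i=i$, equipped with the action $h_t(\varepsilon^i)=t^i\varepsilon^i$ of the multiplicative monoid $(\mathbb R,\cdot)$. A *graded space* is a smooth manifold $V$ with a smooth action $h$ of the monoid $(\mathbb R,\cdot)$ such that $h_0$ maps $V$ to a single point; morphisms are smooth maps intertwining the actions. It has *degree at most $k$* if around every point it admits local coordinates consisting of homogeneous functions on $V$ of weights in $\{1,\dots,k\}$ (a function $y$ is homogeneous of weight $w$ if $y\circ h_t=t^w y$ for all $t\in\mathbb R$). A *free graded Weil algebra with truncation degree $k$* is a finite-dimensional local commutative $\mathbb N$-graded real algebra $A=\mathbb R\oplus N_A$ ($N_A$ the ideal of nilpotent elements) which is generated by finitely many homogeneous elements $y^1,\dots,y^N$, of degrees $w_1,\dots,w_N$, such that a non-zero polynomial $P$, homogeneous with respect to the weights $w_i$, satisfies $P(y^1,\dots,y^N)=0$ if and only if its weighted degree is greater than $k$; equivalently, $A\simeq\mathbb R[y^1,\dots,y^N]/I_k$ with weights $w_i\in\{1,\dots,k\}$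 and $I_k$ the ideal spanned by the polynomials of weight $>k$. Morphisms are unital algebra homomorphisms preserving degrees. For a graded space $V$ of degree at most $k$, let $V^{*[k]}$ be the graded algebra of smooth maps $V\to\mathbb A^{[k]}$ intertwining the actions, with operations and grading defined at the level of values; for a free graded Weil algebra $A$ with truncation degree $k$, let $A^{*[k]}$ be the set of graded algebra homomorphisms $A\to\mathbb A^{[k]}$ with the action $h_t\psi=h_t\circ\psi$ and with the smooth structure given by the global coordinates $\psi\mapsto(\lambda_i)$, $\psi(y^i)=\lambda_i\varepsilon^{w_i}$, for free generators $y^i$ of weights $w_i\in\{1,\dots,k\}$. On morphisms both duals act by precomposition. Then $V^{*[k]}$ is a free graded Weil algebra with truncation degree $k$, $A^{*[k]}$ is a graded space of degree at most $k$, and the two functors $V\mapsto V^{*[k]}$ and $A\mapsto A^{*[k]}$ form an (adjoint) equivalence between the category of graded spaces of degree at most $k$ and the opposite of the category of free graded Weil algebras with truncation degree $k$. The natural isomorphisms $V\to (V^{*[k]})^{*[k]}$ and $A\to (A^{*[k]})^{*[k]}$ are the evaluation maps $P\mapsto(f\mapsto f(P))$ and $a\mapsto(\psi\mapsto\psi(a))$.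 -/

import Mathlib

open CategoryTheory Polynomial
open scoped Manifold ContDiff

universe u v

namespace GradedDuality

noncomputable section

/-! ## Graded algebras -/

/-- An `ℕ`-graded commutative (associative, unital) real algebra. -/
structure GradedAlg : Type (u + 1) where
  carrier : Type u
  [commRing : CommRing carrier]
  [algebra : Algebra ℝ carrier]
  /-- the homogeneous parts -/
  gr : ℕ → Submodule ℝ carrier
  [gradedMonoid : SetLike.GradedMonoid gr]
  isInternal : DirectSum.IsInternal gr

attribute [instance] GradedAlg.commRing GradedAlg.algebra GradedAlg.gradedMonoid

instance : CoeSort GradedAlg.{u} (Type u) := ⟨GradedAlg.carrier⟩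

/-- A graded algebra morphism: a unital algebra homomorphism preserving degrees. -/
@[ext]
structure GradedAlgHom (A : GradedAlg.{u}) (B : GradedAlg.{v}) where
  toAlgHom : A →ₐ[ℝ] B
  map_gr : ∀ (i : ℕ) (a : A), a ∈ A.gr i → toAlgHom a ∈ B.gr i

instance (A : GradedAlg.{u}) (B : GradedAlg.{v}) : CoeFun (GradedAlgHom A B) (fun _ => A → B) :=
  ⟨fun f => f.toAlgHom⟩

instance : Category GradedAlg.{u} where
  Hom A B := GradedAlgHom A B
  id A := ⟨AlgHom.id ℝ A, fun _ _ h => h⟩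
  comp f g := ⟨g.toAlgHom.comp f.toAlgHom, fun i _ h => g.map_gr i _ (f.map_gr i _ h)⟩

/-- A criterion for a family of submodules to be a gradation. -/
theorem isInternal_of_proj {M : Type u} [AddCommGroup M] [Module ℝ M] (N : ℕ → Submodule ℝ M)
    (π : ℕ → M →ₗ[ℝ] M) (k : ℕ) (hmem : ∀ i x, π i x ∈ N i) (hself : ∀ i, ∀ x ∈ N i, π i x = x)
    (hne : ∀ i j, i ≠ j → ∀ x ∈ N j, π i x = 0) (hsum : ∀ x, ∑ i ∈ Finset.range (k + 1), π i x = x) :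
    DirectSum.IsInternal N := by
  classical
  have key : ∀ (i : ℕ) (d : DirectSum ℕ fun i => N i),
      π i (DirectSum.coeAddMonoidHom N d) = d i := by
    intro i d
    induction d using DirectSum.induction_on with
    | zero => simp
    | of j x =>
      rw [DirectSum.coeAddMonoidHom_of]
      by_cases h : i = j
      · subst h
        rw [hself _ _ x.2, DirectSum.of_eq_same]
      · rw [hne i j h _ x.2, DirectSum.of_eq_of_ne _ _ _ h]
        rfl
    | add x y hx hy => simp [hx, hy]
  refine ⟨?_, ?_⟩
  · rw [injective_iff_map_eq_zero]
    intro d hd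
    ext i
    rw [← key i d, hd]
    simp
  · intro x
    refine ⟨∑ i ∈ Finset.range (k + 1), DirectSum.of (fun i => N i) i ⟨π i x, hmem i x⟩, ?_⟩
    rw [map_sum]
    simp only [DirectSum.coeAddMonoidHom_of]
    exact hsum x

/-! ## The model algebra `ℝ[ε]/⟨ε^(k+1)⟩` -/

/-- The algebra `ℝ[ε]/⟨ε^(k+1)⟩`. -/
def Trunc (k : ℕ) : Type := ℝ[X] ⧸ Ideal.span {(X : ℝ[X]) ^ (k + 1)}

namespace Trunc

variable (k : ℕ)

instance : CommRing (Trunc k) :=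
  inferInstanceAs (CommRing (ℝ[X] ⧸ Ideal.span {(X : ℝ[X]) ^ (k + 1)}))

instance : Algebra ℝ (Trunc k) :=
  inferInstanceAs (Algebra ℝ (ℝ[X] ⧸ Ideal.span {(X : ℝ[X]) ^ (k + 1)}))

/-- The quotient map `ℝ[ε] → ℝ[ε]/⟨ε^(k+1)⟩`. -/
def mk : ℝ[X] →ₐ[ℝ] Trunc k := Ideal.Quotient.mkₐ ℝ (Ideal.span {(X : ℝ[X]) ^ (k + 1)})

theorem mk_surjective : Function.Surjective (mk k) := Ideal.Quotient.mk_surjective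

theorem mk_eq_zero_iff (p : ℝ[X]) : mk k p = 0 ↔ (X : ℝ[X]) ^ (k + 1) ∣ p :=
  Ideal.Quotient.eq_zero_iff_mem.trans Ideal.mem_span_singleton

/-- The generator `ε`. -/
def eps : Trunc k := mk k X

variable {k}

theorem eps_pow (i : ℕ) : eps k ^ i = mk k (X ^ i) := by
  rw [eps, ← map_pow]

theorem eps_pow_of_lt {i : ℕ} (hi : k < i) : eps k ^ i = 0 := by
  rw [eps_pow, mk_eq_zero_iff]
  exact pow_dvd_pow _ hi

variable (k)

/-- The homogeneous part of degree `i`: the line spanned by `ε^i` (zero for `i > k`). -/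
def gr (i : ℕ) : Submodule ℝ (Trunc k) := Submodule.span ℝ {eps k ^ i}

/-- The homogeneity structure: `h_t` is the algebra endomorphism with `ε ↦ t ε`,
so `h_t (ε^i) = t^i ε^i`. -/
def h (t : ℝ) : Trunc k →ₐ[ℝ] Trunc k :=
  Ideal.Quotient.liftₐ (Ideal.span {(X : ℝ[X]) ^ (k + 1)}) (aeval (t • eps k)) (by
    intro a ha
    obtain ⟨c, rfl⟩ := Ideal.mem_span_singleton.1 ha
    rw [map_mul, map_pow, aeval_X, _root_.smul_pow, eps_pow_of_lt (Nat.lt_succ_self k), smul_zero,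
      zero_mul])

theorem h_mk (t : ℝ) (p : ℝ[X]) : h k t (mk k p) = aeval (t • eps k) p := rfl

theorem coeff_eq_of_mk_eq {j : ℕ} (hj : j ≤ k) {p q : ℝ[X]} (hpq : mk k p = mk k q) :
    p.coeff j = q.coeff j := by
  have h0 : mk k (p - q) = 0 := by rw [map_sub, hpq, sub_self]
  obtain ⟨c, hc⟩ := (mk_eq_zero_iff k _).1 h0
  have h1 : (p - q).coeff j = 0 := by
    rw [hc, coeff_X_pow_mul']
    exact if_neg (by omega)
  rw [coeff_sub] at h1
  linarith

/-- The coefficient at `ε^j` (zero for `j > k`). -/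
def coeff (j : ℕ) : Trunc k →ₗ[ℝ] ℝ where
  toFun x := if j ≤ k then (Function.surjInv (mk_surjective k) x).coeff j else 0
  map_add' x y := by
    split_ifs with hj
    · rw [← coeff_add]
      refine coeff_eq_of_mk_eq k hj ?_
      rw [map_add]
      simp only [Function.surjInv_eq]
    · simp
  map_smul' c x := by
    split_ifs with hj
    · rw [RingHom.id_apply, ← coeff_smul]
      refine coeff_eq_of_mk_eq k hj ?_
      rw [map_smul]
      simp only [Function.surjInv_eq]
    · simp

variable {k}

theorem coeff_mk {j : ℕ} (hj : j ≤ k) (p : ℝ[X]) : coeff k j (mk k p) = p.coeff j :=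
  (if_pos hj).trans (coeff_eq_of_mk_eq k hj (Function.surjInv_eq _ _))

theorem coeff_of_lt {j : ℕ} (hj : k < j) (x : Trunc k) : coeff k j x = 0 :=
  if_neg (by omega)

theorem coeff_eps_pow {j : ℕ} (hj : j ≤ k) (i : ℕ) :
    coeff k j (eps k ^ i) = if j = i then 1 else 0 := by
  rw [eps_pow, coeff_mk hj, coeff_X_pow]

theorem sum_coeff (x : Trunc k) :
    ∑ i ∈ Finset.range (k + 1), coeff k i x • eps k ^ i = x := by
  obtain ⟨p, rfl⟩ := mk_surjective k x
  have h1 : mk k p = ∑ i ∈ Finset.range (p.natDegree + 1), p.coeff i • eps k ^ i := by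
    conv_lhs => rw [p.as_sum_range_C_mul_X_pow]
    rw [map_sum]
    refine Finset.sum_congr rfl fun i _ => ?_
    rw [eps_pow, ← map_smul, smul_eq_C_mul]
  conv_rhs => rw [h1]
  set g : ℕ → Trunc k := fun i => p.coeff i • eps k ^ i with hg
  have hL : ∑ i ∈ Finset.range (k + 1), coeff k i (mk k p) • eps k ^ i =
      ∑ i ∈ Finset.range (k + 1), g i := by
    refine Finset.sum_congr rfl fun i hi => ?_
    rw [coeff_mk (by simpa [Nat.lt_succ_iff] using hi)]
  rw [hL]
  have e1 : ∑ i ∈ Finset.range (k + 1), g i =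
      ∑ i ∈ Finset.range (max (k + 1) (p.natDegree + 1)), g i := by
    refine Finset.sum_subset (by simp) fun i _ hi => ?_
    simp only [hg]
    rw [eps_pow_of_lt (by simpa using hi), smul_zero]
  have e2 : ∑ i ∈ Finset.range (p.natDegree + 1), g i =
      ∑ i ∈ Finset.range (max (k + 1) (p.natDegree + 1)), g i := by
    refine Finset.sum_subset (by simp) fun i _ hi => ?_
    simp only [hg]
    rw [coeff_eq_zero_of_natDegree_lt (by simpa using hi), zero_smul]
  rw [e1, e2]

theorem ext_coeff {x y : Trunc k} (hxy : ∀ j ≤ k, coeff k j x = coeff k j y) : x = y := by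
  rw [← sum_coeff x, ← sum_coeff y]
  refine Finset.sum_congr rfl fun i hi => ?_
  rw [hxy i (by simpa [Nat.lt_succ_iff] using hi)]

theorem h_eps_pow (t : ℝ) (i : ℕ) : h k t (eps k ^ i) = t ^ i • eps k ^ i := by
  have : h k t (eps k) = t • eps k := by
    rw [eps, h_mk, aeval_X]
    rfl
  rw [map_pow, this, _root_.smul_pow]

theorem coeff_h (t : ℝ) (j : ℕ) (x : Trunc k) : coeff k j (h k t x) = t ^ j * coeff k j x := by
  rcases lt_or_ge k j with hj | hj
  · simp [coeff_of_lt hj]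
  conv_lhs => rw [← sum_coeff x]
  simp only [map_sum, map_smul, h_eps_pow, coeff_eps_pow hj, smul_eq_mul]
  rw [Finset.sum_eq_single j]
  · simp [mul_comm]
  · intro b _ hb
    simp [Ne.symm hb]
  · intro hj'
    exact absurd hj (by simpa using hj')

theorem mem_gr_iff {i : ℕ} {x : Trunc k} : x ∈ gr k i ↔ coeff k i x • eps k ^ i = x := by
  constructor
  · intro hx
    obtain ⟨c, rfl⟩ := Submodule.mem_span_singleton.1 hx
    rcases lt_or_ge k i with hj | hj
    · simp [eps_pow_of_lt hj]
    · simp [coeff_eps_pow hj]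
  · intro hx
    exact Submodule.mem_span_singleton.2 ⟨_, hx⟩

theorem coeff_eq_zero_of_mem {i j : ℕ} (hij : j ≠ i) {x : Trunc k} (hx : x ∈ gr k i) :
    coeff k j x = 0 := by
  rcases lt_or_ge k j with hj | hj
  · exact coeff_of_lt hj x
  · obtain ⟨c, rfl⟩ := Submodule.mem_span_singleton.1 hx
    simp [coeff_eps_pow hj, hij]

variable (k) in
/-- The projection onto the homogeneous part of degree `i`. -/
def proj (i : ℕ) : Trunc k →ₗ[ℝ] Trunc k := (coeff k i).smulRight (eps k ^ i)

theorem proj_apply (i : ℕ) (x : Trunc k) : proj k i x = coeff k i x • eps k ^ i := rfl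

instance : SetLike.GradedMonoid (gr k) where
  one_mem := Submodule.mem_span_singleton.2 ⟨1, by simp⟩
  mul_mem := by
    intro i j x y hx hy
    obtain ⟨c, rfl⟩ := Submodule.mem_span_singleton.1 hx
    obtain ⟨d, rfl⟩ := Submodule.mem_span_singleton.1 hy
    refine Submodule.mem_span_singleton.2 ⟨c * d, ?_⟩
    rw [smul_mul_smul_comm, pow_add]

theorem isInternal : DirectSum.IsInternal (gr k) :=
  isInternal_of_proj (gr k) (proj k) k
    (fun i x => Submodule.mem_span_singleton.2 ⟨_, rfl⟩)
    (fun _ _ hx => mem_gr_iff.1 hx)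
    (fun i j hij x hx => by rw [proj_apply, coeff_eq_zero_of_mem hij hx, zero_smul])
    sum_coeff

theorem coeff_mul {j : ℕ} (hj : j ≤ k) (x y : Trunc k) :
    coeff k j (x * y) =
      ∑ a ∈ Finset.range (k + 1), ∑ b ∈ Finset.range (k + 1),
        coeff k a x * coeff k b y * (if j = a + b then 1 else 0) := by
  conv_lhs => rw [← sum_coeff x, ← sum_coeff y]
  rw [Finset.sum_mul_sum]
  simp only [map_sum, smul_mul_smul_comm, ← pow_add, map_smul, coeff_eps_pow hj, smul_eq_mul]

theorem linearMap_apply (l : Trunc k →ₗ[ℝ] ℝ) (x : Trunc k) :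
    l x = ∑ i ∈ Finset.range (k + 1), coeff k i x * l (eps k ^ i) := by
  conv_lhs => rw [← sum_coeff x]
  simp

end Trunc

/-- The model space `ℝ[ε]/⟨ε^(k+1)⟩` as a graded algebra. -/
abbrev model (k : ℕ) : GradedAlg.{0} where
  carrier := Trunc k
  gr := Trunc.gr k
  isInternal := Trunc.isInternal

/-! ## Graded spaces -/

/-- A graded space: a smooth (Hausdorff, second countable) manifold `V` with a smooth action `h` of the multiplicative
monoid `(ℝ, ·)` such that `h 0` maps all of `V` to one point. -/
structure GradedSpace : Type (u + 1) where
  carrier : Type u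
  dim : ℕ
  [top : TopologicalSpace carrier]
  [t2 : T2Space carrier]
  [secondCountable : SecondCountableTopology carrier]
  [charted : ChartedSpace (EuclideanSpace ℝ (Fin dim)) carrier]
  [manifold : IsManifold (𝓡 dim) ∞ carrier]
  h : ℝ → carrier → carrier
  smooth_h : ContMDiff (𝓘(ℝ, ℝ).prod (𝓡 dim)) (𝓡 dim) ∞
    (fun p : ℝ × carrier => h p.1 p.2)
  h_one : ∀ v, h 1 v = v
  h_mul : ∀ s t v, h (s * t) v = h s (h t v)
  h_zero : ∃ o, ∀ v, h 0 v = o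

attribute [instance] GradedSpace.top GradedSpace.t2 GradedSpace.secondCountable
  GradedSpace.charted GradedSpace.manifold

instance : CoeSort GradedSpace.{u} (Type u) := ⟨GradedSpace.carrier⟩

/-- A morphism of graded spaces: a smooth map intertwining the actions of `(ℝ, ·)`. -/
@[ext]
structure GradedSpaceHom (V W : GradedSpace.{u}) where
  toFun : V → W
  smooth : ContMDiff (𝓡 V.dim) (𝓡 W.dim) ∞ toFun
  map_h : ∀ t v, toFun (V.h t v) = W.h t (toFun v)

instance (V W : GradedSpace.{u}) : CoeFun (GradedSpaceHom V W) (fun _ => V → W) :=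
  ⟨GradedSpaceHom.toFun⟩

instance : Category GradedSpace.{u} where
  Hom V W := GradedSpaceHom V W
  id V := ⟨id, contMDiff_id, fun _ _ => rfl⟩
  comp f g := ⟨g.toFun ∘ f.toFun, g.smooth.comp f.smooth, fun t v => by
    simp only [Function.comp_apply, f.map_h, g.map_h]⟩

/-- A graded space has degree at most `k` if around each of its points there are local
coordinates consisting of homogeneous functions `y^1, …, y^n` on it, of weights in `{1, …, k}`. -/
def HasDegreeLE (k : ℕ) : ObjectProperty GradedSpace.{u} := fun V =>
  ∀ p : V, ∃ (n : ℕ) (w : Fin n → ℕ) (y : V → EuclideanSpace ℝ (Fin n)),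
    (∀ i, 1 ≤ w i ∧ w i ≤ k) ∧
    ContMDiff (𝓡 V.dim) (𝓡 n) ∞ y ∧
    (∀ t v i, y (V.h t v) i = t ^ w i * y v i) ∧
    IsLocalDiffeomorphAt (𝓡 V.dim) (𝓡 n) ∞ y p

/-- The category of graded spaces of degree at most `k`. -/
abbrev GrSp (k : ℕ) := (HasDegreeLE.{u} k).FullSubcategory

/-! ## The `k`-th dual of a graded space -/

/-- Smoothness of a map into the finite-dimensional real vector space `ℝ[ε]/⟨ε^(k+1)⟩`. -/
def SmoothToTrunc (k : ℕ) (V : GradedSpace.{u}) (f : V → Trunc k) : Prop :=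
  ∀ l : Trunc k →ₗ[ℝ] ℝ, ContMDiff (𝓡 V.dim) 𝓘(ℝ, ℝ) ∞ (fun v => l (f v))

theorem smoothToTrunc_iff {k : ℕ} {V : GradedSpace.{u}} {f : V → Trunc k} :
    SmoothToTrunc k V f ↔
      ∀ j ≤ k, ContMDiff (𝓡 V.dim) 𝓘(ℝ, ℝ) ∞ (fun v => Trunc.coeff k j (f v)) := by
  refine ⟨fun hf j _ => hf _, fun hf l => ?_⟩
  have : (fun v => l (f v)) = fun v => ∑ i ∈ Finset.range (k + 1),
      Trunc.coeff k i (f v) * l (Trunc.eps k ^ i) := by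
    funext v
    exact Trunc.linearMap_apply l _
  rw [this]
  refine contMDiff_finsetSum fun i hi => ?_
  exact (hf i (by simpa [Nat.lt_succ_iff] using hi)).mul contMDiff_const

/-- The algebra of smooth maps `V → ℝ[ε]/⟨ε^(k+1)⟩` intertwining the homogeneity structures,
with the operations defined at the level of values. -/
def homG (k : ℕ) (V : GradedSpace.{u}) : Subalgebra ℝ (V → Trunc k) where
  carrier := {f | SmoothToTrunc k V f ∧ ∀ t v, f (V.h t v) = Trunc.h k t (f v)}
  mul_mem' := by
    rintro f g ⟨hf, hf'⟩ ⟨hg, hg'⟩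
    refine ⟨smoothToTrunc_iff.2 fun j hj => ?_, fun t v => by simp [hf', hg']⟩
    simp only [Pi.mul_apply, Trunc.coeff_mul hj]
    refine contMDiff_finsetSum fun a _ => contMDiff_finsetSum fun b _ => ?_
    exact ((hf _).mul (hg _)).mul contMDiff_const
  add_mem' := by
    rintro f g ⟨hf, hf'⟩ ⟨hg, hg'⟩
    refine ⟨fun l => ?_, fun t v => by simp [hf', hg']⟩
    simp only [Pi.add_apply, map_add]
    exact (hf l).add (hg l)
  algebraMap_mem' := by
    intro r
    refine ⟨fun l => ?_, fun t v => ?_⟩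
    · simp only [Pi.algebraMap_apply]
      exact contMDiff_const
    · simp only [Pi.algebraMap_apply]
      exact ((Trunc.h k t).commutes r).symm

/-- The homogeneous part of degree `i` of the `k`-th dual: the maps with values in the
homogeneous part of degree `i` of `ℝ[ε]/⟨ε^(k+1)⟩`. -/
def homGr (k : ℕ) (V : GradedSpace.{u}) (i : ℕ) : Submodule ℝ (homG k V) where
  carrier := {f | ∀ v, f.1 v ∈ Trunc.gr k i}
  add_mem' := fun hf hg v => (Trunc.gr k i).add_mem (hf v) (hg v)
  zero_mem' := fun _ => (Trunc.gr k i).zero_mem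
  smul_mem' := fun c _ hf v => (Trunc.gr k i).smul_mem c (hf v)

instance (k : ℕ) (V : GradedSpace.{u}) : SetLike.GradedMonoid (homGr k V) where
  one_mem := fun _ => SetLike.GradedOne.one_mem (A := Trunc.gr k)
  mul_mem := fun _ _ _ _ hf hg v => SetLike.GradedMul.mul_mem (A := Trunc.gr k) (hf v) (hg v)

/-- The homogeneous components of an element of the `k`-th dual. -/
def homProj (k : ℕ) (V : GradedSpace.{u}) (i : ℕ) : homG k V →ₗ[ℝ] homG k V where
  toFun f := ⟨fun v => Trunc.proj k i (f.1 v), by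
    refine ⟨fun l => f.2.1 (l ∘ₗ Trunc.proj k i), fun t v => ?_⟩
    change Trunc.proj k i (f.1 (V.h t v)) = Trunc.h k t (Trunc.proj k i (f.1 v))
    rw [f.2.2, Trunc.proj_apply, Trunc.proj_apply, Trunc.coeff_h, map_smul, Trunc.h_eps_pow,
      smul_smul, mul_comm]⟩
  map_add' f g := by
    ext v : 2
    exact map_add (Trunc.proj k i) (f.1 v) (g.1 v)
  map_smul' c f := by
    ext v : 2
    exact map_smul (Trunc.proj k i) c (f.1 v)

theorem homG_isInternal (k : ℕ) (V : GradedSpace.{u}) : DirectSum.IsInternal (homGr k V) :=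
  isInternal_of_proj (homGr k V) (homProj k V) k
    (fun i f v => Submodule.mem_span_singleton.2 ⟨_, rfl⟩)
    (fun i f hf => by
      ext v : 2
      exact Trunc.mem_gr_iff.1 (hf v))
    (fun i j hij f hf => by
      ext v : 2
      change Trunc.proj k i (f.1 v) = 0
      rw [Trunc.proj_apply, Trunc.coeff_eq_zero_of_mem hij (hf v), zero_smul])
    (fun f => by
      ext v : 2
      rw [AddSubmonoidClass.coe_finsetSum, Finset.sum_apply]
      exact Trunc.sum_coeff (f.1 v))

/-- The `k`-th dual of a graded space, as a graded algebra. -/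
def spaceDual (k : ℕ) (V : GradedSpace.{u}) : GradedAlg.{u} where
  carrier := homG k V
  gr := homGr k V
  isInternal := homG_isInternal k V

/-- The `k`-th dual of a morphism `f` of graded spaces: `α ↦ α ∘ f`. -/
def homGMap (k : ℕ) {V W : GradedSpace.{u}} (f : GradedSpaceHom V W) :
    homG k W →ₐ[ℝ] homG k V where
  toFun α := ⟨fun v => α.1 (f v), fun l => (α.2.1 l).comp f.smooth, fun t v =>
    (congrArg α.1 (f.map_h t v)).trans (α.2.2 t (f v))⟩
  map_one' := rfl
  map_mul' _ _ := rfl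
  map_zero' := rfl
  map_add' _ _ := rfl
  commutes' _ := rfl

/-- The `k`-th dual as a functor on all graded spaces. -/
def spaceDualFunctor (k : ℕ) : GradedSpace.{u} ⥤ GradedAlg.{u}ᵒᵖ where
  obj V := Opposite.op (spaceDual k V)
  map f := Quiver.Hom.op
    (show GradedAlgHom (spaceDual k _) (spaceDual k _) from
      ⟨homGMap k f, fun _ _ hα v => hα (f.toFun v)⟩)
  map_id _ := rfl
  map_comp _ _ := rfl

/-! ## Free graded Weil algebras -/

/-- A graded Weil algebra: a finite-dimensional local algebra `A = ℝ ⊕ N`, with `N` the ideal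
of nilpotent elements, equipped with a gradation by non-negative integers. -/
structure IsGradedWeil (A : GradedAlg.{u}) : Prop where
  finite : Module.Finite ℝ A
  isLocalRing : IsLocalRing A
  exists_sub_isNilpotent : ∀ a : A, ∃ r : ℝ, IsNilpotent (a - algebraMap ℝ A r)

/-- `y` is a family of free Weil generators, with weights `w`, of `A`, relative to `k`: the `y i`
are homogeneous of degree `w i`, generate `A`, and a non-zero polynomial `P` that is
homogeneous for the weights `w` satisfies `P(y) = 0` if and only if its degree exceeds `k`. -/
structure IsFreeWeilGen (k : ℕ) (A : GradedAlg.{u}) {σ : Type} (w : σ → ℕ) (y : σ → A) :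
    Prop where
  mem : ∀ i, y i ∈ A.gr (w i)
  adjoin_eq_top : Algebra.adjoin ℝ (Set.range y) = ⊤
  aeval_eq_zero_iff : ∀ (m : ℕ) (P : MvPolynomial σ ℝ), P.IsWeightedHomogeneous w m → P ≠ 0 →
    (MvPolynomial.aeval y P = 0 ↔ k < m)

/-- The free graded Weil algebras with truncation degree `k`, i.e. the graded Weil algebras
which admit a finite family of free Weil generators relative to `k`. -/
def IsFreeGradedWeil (k : ℕ) : ObjectProperty GradedAlg.{u} := fun A =>
  IsGradedWeil A ∧ ∃ (n : ℕ) (w : Fin n → ℕ) (y : Fin n → A), IsFreeWeilGen k A w y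

/-- The category of free graded Weil algebras with truncation degree `k`. -/
abbrev FGWA (k : ℕ) := (IsFreeGradedWeil.{u} k).FullSubcategory

theorem isWeightedHomogeneous_rename {σ τ : Type} (f : σ → τ) (w : τ → ℕ) {m : ℕ}
    {P : MvPolynomial σ ℝ} (hP : P.IsWeightedHomogeneous (w ∘ f) m) :
    (MvPolynomial.rename f P).IsWeightedHomogeneous w m := by
  intro d hd
  obtain ⟨u, rfl, hu⟩ := MvPolynomial.coeff_rename_ne_zero f P d hd
  rw [← hP hu, Finsupp.weight, Finsupp.weight]
  exact Finsupp.linearCombination_mapDomain ℕ f u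

theorem isWeightedHomogeneous_aeval_X {σ : Type} (w : σ → ℕ) (i : σ) (hi : w i = 0) (p : ℝ[X]) :
    (aeval (MvPolynomial.X i : MvPolynomial σ ℝ) p).IsWeightedHomogeneous w 0 := by
  rw [aeval_eq_sum_range]
  refine (MvPolynomial.weightedHomogeneousSubmodule ℝ w 0).sum_mem fun j _ =>
    (MvPolynomial.weightedHomogeneousSubmodule ℝ w 0).smul_mem _ ?_
  have := (MvPolynomial.isWeightedHomogeneous_X ℝ w i).pow j
  rwa [hi, smul_zero] at this

/-- Free Weil generators may be chosen with weights in `{1, …, k}`. -/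
theorem exists_gen {k : ℕ} {A : GradedAlg.{u}} (hA : IsFreeGradedWeil k A) :
    ∃ (n : ℕ) (w : Fin n → ℕ) (y : Fin n → A), (∀ i, 1 ≤ w i ∧ w i ≤ k) ∧
      IsFreeWeilGen k A w y := by
  classical
  obtain ⟨hW, n, w, y, hy⟩ := hA
  have hpos : ∀ i, 1 ≤ w i := by
    intro i
    by_contra hi
    have hi0 : w i = 0 := by omega
    have := hW.finite
    obtain ⟨p, hp0, hp⟩ := Algebra.IsAlgebraic.isAlgebraic (R := ℝ) (y i)
    have hne : aeval (MvPolynomial.X i : MvPolynomial (Fin n) ℝ) p ≠ 0 := by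
      intro h0
      exact hp0 ((transcendental_iff.1 (MvPolynomial.transcendental_X ℝ i)) p h0)
    have h1 := (hy.aeval_eq_zero_iff 0 _ (isWeightedHomogeneous_aeval_X w i hi0 p) hne).1 (by
      rw [← aeval_algHom_apply, MvPolynomial.aeval_X]
      exact hp)
    omega
  have hzero : ∀ i, k < w i → y i = 0 := by
    intro i hi
    have := (hy.aeval_eq_zero_iff (w i) _ (MvPolynomial.isWeightedHomogeneous_X ℝ w i)
      (MvPolynomial.X_ne_zero i)).2 hi
    rwa [MvPolynomial.aeval_X] at this
  let S := {i : Fin n // w i ≤ k}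
  let e : Fin (Fintype.card S) ≃ S := (Fintype.equivFin S).symm
  let f : Fin (Fintype.card S) → Fin n := fun i => (e i).1
  have hf : Function.Injective f := Subtype.val_injective.comp e.injective
  refine ⟨_, w ∘ f, y ∘ f, fun i => ⟨hpos _, (e i).2⟩, fun i => hy.mem _, ?_, ?_⟩
  · rw [eq_top_iff, ← hy.adjoin_eq_top]
    refine Algebra.adjoin_le ?_
    rintro _ ⟨i, rfl⟩
    by_cases hi : w i ≤ k
    · refine Algebra.subset_adjoin ⟨e.symm ⟨i, hi⟩, ?_⟩
      simp [f]
    · rw [hzero i (by omega)]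
      exact Subalgebra.zero_mem _
  · intro m P hP hP0
    have := hy.aeval_eq_zero_iff m (MvPolynomial.rename f P) (isWeightedHomogeneous_rename f w hP)
      (fun h0 => hP0 ((MvPolynomial.rename_injective f hf) (by rw [h0, map_zero])))
    rwa [MvPolynomial.aeval_rename] at this

/-! ## The `k`-th dual of a free graded Weil algebra -/

/-- The set of graded algebra homomorphisms `A → ℝ[ε]/⟨ε^(k+1)⟩`. -/
abbrev HomGr (k : ℕ) (A : GradedAlg.{u}) : Type u := GradedAlgHom A (model k)

/-- The action of `(ℝ, ·)` on `HomGr k A`: `h_t ψ = h_t ∘ ψ`. -/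
def homGrAct {k : ℕ} {A : GradedAlg.{u}} (t : ℝ) (ψ : HomGr k A) : HomGr k A where
  toAlgHom := (Trunc.h k t).comp ψ.toAlgHom
  map_gr i a ha := by
    obtain ⟨c, hc⟩ := Submodule.mem_span_singleton.1 (ψ.map_gr i a ha)
    refine Submodule.mem_span_singleton.2 ⟨t ^ i * c, ?_⟩
    rw [AlgHom.comp_apply, ← hc, map_smul, Trunc.h_eps_pow, smul_smul, mul_comm]

/-- Precomposition with a graded algebra morphism `φ`: `ζ ↦ ζ ∘ φ`. -/
def homGrMap {k : ℕ} {A B : GradedAlg.{u}} (φ : GradedAlgHom A B) (ζ : HomGr k B) : HomGr k A where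
  toAlgHom := ζ.toAlgHom.comp φ.toAlgHom
  map_gr i a ha := ζ.map_gr i _ (φ.map_gr i a ha)

/-- The coordinates on `HomGr k A` defined by homogeneous elements `y i` of `A`, of degree `w i`:
`ψ (y i) = λ_i ε^(w i)`. -/
def homGrCoord {k n : ℕ} {A : GradedAlg.{u}} (w : Fin n → ℕ) (y : Fin n → A) (ψ : HomGr k A) :
    EuclideanSpace ℝ (Fin n) :=
  WithLp.toLp 2 fun i => Trunc.coeff k (w i) (ψ (y i))

theorem homGr_apply_gen {k n : ℕ} {A : GradedAlg.{u}} {w : Fin n → ℕ} {y : Fin n → A}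
    (hy : IsFreeWeilGen k A w y) (ψ : HomGr k A) (i : Fin n) :
    ψ (y i) = homGrCoord w y ψ i • Trunc.eps k ^ w i :=
  (Trunc.mem_gr_iff.1 (ψ.map_gr _ _ (hy.mem i))).symm

theorem aeval_mem_of_isWeightedHomogeneous {A : GradedAlg.{u}} {σ : Type} (w : σ → ℕ) (y : σ → A)
    (hy : ∀ i, y i ∈ A.gr (w i)) (m : ℕ) (P : MvPolynomial σ ℝ)
    (hP : P.IsWeightedHomogeneous w m) : MvPolynomial.aeval y P ∈ A.gr m := by
  rw [MvPolynomial.aeval_def, MvPolynomial.eval₂_eq]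
  refine (A.gr m).sum_mem fun d hd => ?_
  rw [← Algebra.smul_def]
  refine (A.gr m).smul_mem _ ?_
  have h1 : ∏ i ∈ d.support, y i ^ d i ∈ A.gr (∑ i ∈ d.support, d i • w i) :=
    SetLike.prod_mem_graded _ _ _ fun i _ => SetLike.pow_mem_graded _ (hy i)
  have h2 : ∑ i ∈ d.support, d i • w i = m := by
    rw [← hP (MvPolynomial.mem_support_iff.1 hd), Finsupp.weight_apply]
    rfl
  rwa [h2] at h1

theorem eq_zero_of_sum_eq_zero (A : GradedAlg.{u}) (s : Finset ℕ) (x : ℕ → A)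
    (hx : ∀ i, x i ∈ A.gr i) (h0 : ∑ i ∈ s, x i = 0) : ∀ i ∈ s, x i = 0 := by
  classical
  intro i hi
  have h1 : ∑ i ∈ s, DirectSum.of (fun i => A.gr i) i ⟨x i, hx i⟩ = 0 := by
    refine (injective_iff_map_eq_zero _).1 A.isInternal.1 _ ?_
    rw [map_sum]
    simp only [DirectSum.coeAddMonoidHom_of]
    exact h0
  let g : (DirectSum ℕ fun i => A.gr i) →+ A :=
    (A.gr i).subtype.toAddMonoidHom.comp (DFinsupp.evalAddMonoidHom i)
  have hg : ∀ j, g (DirectSum.of (fun i => A.gr i) j ⟨x j, hx j⟩) = if j = i then x i else 0 := by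
    intro j
    change ((DirectSum.of (fun i => A.gr i) j ⟨x j, hx j⟩ i : A.gr i) : A) = _
    split_ifs with hj
    · subst hj
      rw [DirectSum.of_eq_same]
    · rw [DirectSum.of_eq_of_ne _ _ _ (Ne.symm hj)]
      rfl
  have h2 := congrArg g h1
  rw [map_sum, map_zero] at h2
  simp only [hg] at h2
  rwa [Finset.sum_ite_eq', if_pos hi] at h2

theorem exists_sum_weighted {σ : Type} (w : σ → ℕ) (p : MvPolynomial σ ℝ) (m : ℕ) :
    ∃ s : Finset ℕ, m ∈ s ∧ ∑ j ∈ s, MvPolynomial.weightedHomogeneousComponent w j p = p := by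
  classical
  refine ⟨insert m (MvPolynomial.weightedHomogeneousComponent_finsupp (w := w) p).toFinset,
    Finset.mem_insert_self _ _, ?_⟩
  conv_rhs => rw [← MvPolynomial.sum_weightedHomogeneousComponent w p]
  refine (finsum_eq_sum_of_support_subset _ ?_).symm
  intro j hj
  exact Finset.mem_coe.2 (Finset.mem_insert_of_mem ((Set.Finite.mem_toFinset _).2 hj))

section coord

variable {k n : ℕ} {A : GradedAlg.{u}} {w : Fin n → ℕ} {y : Fin n → A}

theorem exists_homGr (hy : IsFreeWeilGen k A w y) (c : Fin n → ℝ) :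
    ∃ ψ : HomGr k A, ∀ i, ψ (y i) = c i • Trunc.eps k ^ w i := by
  classical
  let z : Fin n → model k := fun i => c i • Trunc.eps k ^ w i
  have hz : ∀ i, z i ∈ (model k).gr (w i) := fun i => Submodule.mem_span_singleton.2 ⟨_, rfl⟩
  have hsurj : Function.Surjective (MvPolynomial.aeval (R := ℝ) y) := by
    rw [← AlgHom.range_eq_top, ← Algebra.adjoin_range_eq_range_aeval, hy.adjoin_eq_top]
  have hker : ∀ p, MvPolynomial.aeval (R := ℝ) y p = 0 → MvPolynomial.aeval (R := ℝ) z p = 0 := by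
    intro p hp
    obtain ⟨s, -, hs⟩ := exists_sum_weighted w p 0
    have h1 := eq_zero_of_sum_eq_zero A s
      (fun j => MvPolynomial.aeval y (MvPolynomial.weightedHomogeneousComponent w j p))
      (fun j => aeval_mem_of_isWeightedHomogeneous w y hy.mem j _
        (MvPolynomial.weightedHomogeneousComponent_isWeightedHomogeneous _ _))
      (by rw [← map_sum, hs, hp])
    rw [← hs, map_sum]
    refine Finset.sum_eq_zero fun j hj => ?_
    by_cases h0 : MvPolynomial.weightedHomogeneousComponent w j p = 0
    · rw [h0, map_zero]
    · have hj' := (hy.aeval_eq_zero_iff j _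
        (MvPolynomial.weightedHomogeneousComponent_isWeightedHomogeneous _ _) h0).1 (h1 j hj)
      have h2 := aeval_mem_of_isWeightedHomogeneous (A := model k) w z hz j _
        (MvPolynomial.weightedHomogeneousComponent_isWeightedHomogeneous (w := w) j p)
      rw [← Trunc.mem_gr_iff.1 h2, Trunc.eps_pow_of_lt hj', smul_zero]
  let ψ : A →ₐ[ℝ] model k := AlgHom.liftOfSurjective (MvPolynomial.aeval y) hsurj
    (MvPolynomial.aeval z) (fun p hp => hker p hp)
  have hψ : ∀ p, ψ (MvPolynomial.aeval y p) = MvPolynomial.aeval z p := fun p =>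
    AlgHom.liftOfSurjective_apply _ _ _ _ p
  refine ⟨⟨ψ, ?_⟩, fun i => ?_⟩
  · intro m a ha
    obtain ⟨p, rfl⟩ := hsurj a
    obtain ⟨s, hm, hs⟩ := exists_sum_weighted w p m
    have h1 := eq_zero_of_sum_eq_zero A s
      (fun j => MvPolynomial.aeval y (MvPolynomial.weightedHomogeneousComponent w j p) -
        if j = m then MvPolynomial.aeval y p else 0)
      (fun j => by
        refine (A.gr j).sub_mem (aeval_mem_of_isWeightedHomogeneous w y hy.mem j _
          (MvPolynomial.weightedHomogeneousComponent_isWeightedHomogeneous _ _)) ?_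
        split_ifs with hjm
        · exact hjm ▸ ha
        · exact Submodule.zero_mem _)
      (by
        rw [Finset.sum_sub_distrib, ← map_sum, hs, Finset.sum_ite_eq' s m, if_pos hm, sub_self])
    have h2 := h1 m hm
    simp only [if_true] at h2
    rw [← sub_eq_zero.1 h2, hψ]
    exact aeval_mem_of_isWeightedHomogeneous (A := model k) w z hz m _
      (MvPolynomial.weightedHomogeneousComponent_isWeightedHomogeneous (w := w) m p)
  · have := hψ (MvPolynomial.X i)
    rwa [MvPolynomial.aeval_X, MvPolynomial.aeval_X] at this

theorem homGrCoord_bijective (hy : IsFreeWeilGen k A w y) (hw : ∀ i, w i ≤ k) :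
    Function.Bijective (homGrCoord (k := k) w y) := by
  constructor
  · intro ψ ψ' h
    ext1
    refine AlgHom.ext_of_adjoin_eq_top hy.adjoin_eq_top ?_
    rintro _ ⟨i, rfl⟩
    exact (homGr_apply_gen hy ψ i).trans ((congrArg
      (fun x : EuclideanSpace ℝ (Fin n) => x i • Trunc.eps k ^ w i) h).trans
      (homGr_apply_gen hy ψ' i).symm)
  · intro c
    obtain ⟨ψ, hψ⟩ := exists_homGr hy (fun i => c i)
    refine ⟨ψ, ?_⟩
    ext i
    change Trunc.coeff k (w i) (ψ (y i)) = c i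
    rw [hψ, map_smul, Trunc.coeff_eps_pow (hw i)]
    simp

theorem homGrCoord_act (t : ℝ) (ψ : HomGr k A) (i : Fin n) :
    homGrCoord w y (homGrAct t ψ) i = t ^ w i * homGrCoord w y ψ i :=
  Trunc.coeff_h t (w i) (ψ (y i))

end coord

section chart

/-! ### The smooth structure on a set given by a global coordinate system -/

variable {T : Type u} {n : ℕ} (e : T ≃ EuclideanSpace ℝ (Fin n))

/-- The topology given by a global coordinate system. -/
abbrev coordTop : TopologicalSpace T := TopologicalSpace.induced e inferInstance

/-- A global coordinate system as a homeomorphism. -/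
def coordHomeo : @Homeomorph T (EuclideanSpace ℝ (Fin n)) (coordTop e) _ :=
  letI := coordTop e
  e.toHomeomorphOfIsInducing ⟨rfl⟩

/-- The atlas given by a global coordinate system. -/
abbrev coordCharted :
    @ChartedSpace (EuclideanSpace ℝ (Fin n)) _ T (coordTop e) :=
  letI := coordTop e
  (coordHomeo e).toOpenPartialHomeomorph.singletonChartedSpace rfl

theorem coordManifold :
    letI := coordTop e
    letI := coordCharted e
    IsManifold (𝓡 n) ∞ T := by
  let := coordTop e
  let := coordCharted e
  have := (coordHomeo e).toOpenPartialHomeomorph.singleton_hasGroupoid rfl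
    (contDiffGroupoid ∞ (𝓡 n))
  exact IsManifold.mk' _ _ _

theorem coord_mem_maximalAtlas :
    letI := coordTop e
    letI := coordCharted e
    (coordHomeo e).toOpenPartialHomeomorph ∈ IsManifold.maximalAtlas (𝓡 n) ∞ T := by
  let := coordTop e
  let := coordCharted e
  have := coordManifold e
  exact IsManifold.subset_maximalAtlas rfl

theorem contMDiff_coord :
    letI := coordTop e
    letI := coordCharted e
    ContMDiff (𝓡 n) (𝓡 n) ∞ e := by
  let := coordTop e
  let := coordCharted e
  have := coordManifold e
  rw [← contMDiffOn_univ]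
  exact contMDiffOn_of_mem_maximalAtlas (coord_mem_maximalAtlas e)

theorem contMDiff_coord_symm :
    letI := coordTop e
    letI := coordCharted e
    ContMDiff (𝓡 n) (𝓡 n) ∞ e.symm := by
  let := coordTop e
  let := coordCharted e
  have := coordManifold e
  rw [← contMDiffOn_univ]
  exact contMDiffOn_symm_of_mem_maximalAtlas (coord_mem_maximalAtlas e)

end chart

theorem contMDiff_euclidean_of {E H M : Type*} [NormedAddCommGroup E] [NormedSpace ℝ E]
    [TopologicalSpace H] {I : ModelWithCorners ℝ E H} [TopologicalSpace M] [ChartedSpace H M]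
    {n : ℕ} {f : M → EuclideanSpace ℝ (Fin n)}
    (hf : ∀ i, ContMDiff I 𝓘(ℝ, ℝ) ∞ (fun x => f x i)) : ContMDiff I (𝓡 n) ∞ f :=
  (EuclideanSpace.equiv (Fin n) ℝ).symm.contDiff.contMDiff.comp (contMDiff_pi_space.2 hf)

theorem contMDiff_apply_euclidean {n : ℕ} (i : Fin n) :
    ContMDiff (𝓡 n) 𝓘(ℝ, ℝ) ∞ (fun x : EuclideanSpace ℝ (Fin n) => x i) :=
  (EuclideanSpace.proj (𝕜 := ℝ) i).contDiff.contMDiff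

section algDual

variable {k : ℕ} {A : GradedAlg.{u}} (hA : IsFreeGradedWeil k A)

/-- The number of the chosen free Weil generators of `A`. -/
def genNum : ℕ := (exists_gen hA).choose

/-- The weights of the chosen free Weil generators of `A`. -/
def genWt : Fin (genNum hA) → ℕ := (exists_gen hA).choose_spec.choose

/-- A chosen family of free Weil generators of `A`. -/
def gen : Fin (genNum hA) → A := (exists_gen hA).choose_spec.choose_spec.choose

theorem genWt_mem (i : Fin (genNum hA)) : 1 ≤ genWt hA i ∧ genWt hA i ≤ k :=
  (exists_gen hA).choose_spec.choose_spec.choose_spec.1 i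

theorem gen_free : IsFreeWeilGen k A (genWt hA) (gen hA) :=
  (exists_gen hA).choose_spec.choose_spec.choose_spec.2

/-- The global coordinates on `HomGr k A` given by the chosen free Weil generators. -/
def algCoord : HomGr k A ≃ EuclideanSpace ℝ (Fin (genNum hA)) :=
  Equiv.ofBijective _ (homGrCoord_bijective (gen_free hA) fun i => (genWt_mem hA i).2)

theorem algCoord_act (t : ℝ) (ψ : HomGr k A) (i : Fin (genNum hA)) :
    algCoord hA (homGrAct t ψ) i = t ^ genWt hA i * algCoord hA ψ i :=
  homGrCoord_act t ψ i

/-- The `k`-th dual of a free graded Weil algebra `A` as a graded space: the set of graded algebra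
homomorphisms `A → ℝ[ε]/⟨ε^(k+1)⟩` with the homogeneity structure `h_t ψ = h_t ∘ ψ` and the smooth
structure in which the coordinates given by free Weil generators form a global chart. This smooth
structure does not depend on the choice of the generators, because for each choice the coefficients
of `ψ ↦ ψ a` are smooth functions for all `a` in `A` (see `contMDiff_coeff_eval`). -/
def algDual : GradedSpace.{u} :=
  letI := coordTop (algCoord hA)
  letI := coordCharted (algCoord hA)
  { carrier := HomGr k A
    dim := genNum hA
    t2 := (coordHomeo (algCoord hA)).symm.t2Space
    secondCountable := (coordHomeo (algCoord hA)).secondCountableTopology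
    manifold := coordManifold (algCoord hA)
    h := homGrAct
    smooth_h := by
      have h1 : (fun p : ℝ × HomGr k A => homGrAct p.1 p.2) = (algCoord hA).symm ∘
          fun p : ℝ × HomGr k A => algCoord hA (homGrAct p.1 p.2) := by
        funext p
        simp
      rw [h1]
      refine (contMDiff_coord_symm (algCoord hA)).comp (contMDiff_euclidean_of fun i => ?_)
      simp only [algCoord_act]
      exact (contMDiff_fst.pow _).mul ((contMDiff_apply_euclidean i).comp
        ((contMDiff_coord (algCoord hA)).comp contMDiff_snd))
    h_one := fun ψ => (algCoord hA).injective (by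
      ext i
      simp [algCoord_act])
    h_mul := fun s t ψ => (algCoord hA).injective (by
      ext i
      simp [algCoord_act, mul_pow, mul_assoc])
    h_zero := ⟨(algCoord hA).symm 0, fun ψ => (algCoord hA).injective (by
      ext i
      simp [algCoord_act, Nat.one_le_iff_ne_zero.1 (genWt_mem hA i).1])⟩ }

theorem contMDiff_algCoord :
    ContMDiff (𝓡 (algDual hA).dim) (𝓡 (genNum hA)) ∞
      (fun ψ : algDual hA => algCoord hA ψ) :=
  contMDiff_coord (algCoord hA)

theorem algDual_hasDegreeLE : HasDegreeLE k (algDual hA) := by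
  intro p
  refine ⟨genNum hA, genWt hA, algCoord hA, genWt_mem hA, contMDiff_algCoord hA,
    fun t ψ i => algCoord_act hA t ψ i, ?_⟩
  let := coordTop (algCoord hA)
  let := coordCharted (algCoord hA)
  let Φ : HomGr k A ≃ₘ^∞⟮𝓡 (genNum hA), 𝓡 (genNum hA)⟯ EuclideanSpace ℝ (Fin (genNum hA)) :=
    { toEquiv := algCoord hA
      contMDiff_toFun := contMDiff_coord (algCoord hA)
      contMDiff_invFun := contMDiff_coord_symm (algCoord hA) }
  exact Φ.isLocalDiffeomorph p

/-- The evaluations at elements of `A` are smooth on the `k`-th dual of `A`. -/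
theorem contMDiff_coeff_eval (a : A) : ∀ j ≤ k,
    ContMDiff (𝓡 (algDual hA).dim) 𝓘(ℝ, ℝ) ∞
      (fun ψ : algDual hA => Trunc.coeff k j (GradedAlgHom.toAlgHom ψ a)) := by
  have ha : a ∈ Algebra.adjoin ℝ (Set.range (gen hA)) := by
    rw [(gen_free hA).adjoin_eq_top]
    trivial
  induction ha using Algebra.adjoin_induction with
  | mem x hx =>
    obtain ⟨i, rfl⟩ := hx
    intro j _
    have h1 : (fun ψ : algDual hA => Trunc.coeff k j (GradedAlgHom.toAlgHom ψ (gen hA i))) =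
        fun ψ : algDual hA => algCoord hA ψ i * Trunc.coeff k j (Trunc.eps k ^ genWt hA i) := by
      funext ψ
      refine (congrArg (Trunc.coeff k j) (homGr_apply_gen (gen_free hA) ψ i)).trans ?_
      rw [map_smul]
      rfl
    rw [h1]
    exact ((contMDiff_apply_euclidean i).comp (contMDiff_algCoord hA)).mul contMDiff_const
  | algebraMap r =>
    intro j _
    simp only [AlgHom.commutes]
    exact contMDiff_const
  | add x y _ _ hx hy =>
    intro j hj
    simp only [map_add]
    exact (hx j hj).add (hy j hj)
  | mul x y _ _ hx hy =>
    intro j hj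
    simp only [map_mul, Trunc.coeff_mul hj]
    refine contMDiff_finsetSum fun a ha => contMDiff_finsetSum fun b hb => ?_
    exact ((hx a (by simpa [Nat.lt_succ_iff] using ha)).mul
      (hy b (by simpa [Nat.lt_succ_iff] using hb))).mul contMDiff_const

end algDual

/-- The `k`-th dual of a morphism `φ : A → B` of free graded Weil algebras: `ζ ↦ ζ ∘ φ`. -/
def algDualMap {k : ℕ} {A B : GradedAlg.{u}} (hA : IsFreeGradedWeil k A)
    (hB : IsFreeGradedWeil k B) (φ : GradedAlgHom A B) :
    GradedSpaceHom (algDual hB) (algDual hA) where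
  toFun := homGrMap φ
  smooth := by
    have h1 : (homGrMap (k := k) φ) = (algCoord hA).symm ∘
        fun ζ => algCoord hA (homGrMap φ ζ) := by
      funext ζ
      simp
    rw [h1]
    let := coordTop (algCoord hA)
    let := coordCharted (algCoord hA)
    refine ContMDiff.comp (I' := 𝓡 (genNum hA)) (contMDiff_coord_symm (algCoord hA))
      (contMDiff_euclidean_of fun i => ?_)
    exact contMDiff_coeff_eval hB (φ (gen hA i)) (genWt hA i) (genWt_mem hA i).2
  map_h _ _ := rfl

/-- The `k`-th duality functor from free graded Weil algebras to graded spaces. -/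
def algDualFunctor (k : ℕ) : (FGWA.{u} k)ᵒᵖ ⥤ GrSp.{u} k where
  obj A := ⟨algDual A.unop.property, algDual_hasDegreeLE A.unop.property⟩
  map {A B} φ := ObjectProperty.homMk (algDualMap B.unop.property A.unop.property φ.unop.hom)
  map_id _ := rfl
  map_comp _ _ := rfl

/-- The `k`-th duality functor from graded spaces of degree at most `k` to free graded Weil
algebras, given that the duals of these spaces are free graded Weil algebras. -/
def spaceDualFunctorLE (k : ℕ)
    (hk : ∀ V : GradedSpace.{u}, HasDegreeLE k V → IsFreeGradedWeil k (spaceDual k V)) :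
    GrSp.{u} k ⥤ (FGWA.{u} k)ᵒᵖ where
  obj V := Opposite.op ⟨spaceDual k V.obj, hk V.obj V.property⟩
  map f := Quiver.Hom.op (ObjectProperty.homMk ((spaceDualFunctor k).map f.hom).unop)
  map_id _ := rfl
  map_comp _ _ := rfl

end

end GradedDuality

/-! Two rigidity facts carry the equivalence. First, `exists_polynomial_of_homogeneous`: a smooth
function of weight `m` on `ℝⁿ` with positive coordinate weights is a weighted homogeneous
polynomial. Its partial derivatives have the smaller weights `m - w_j`, Euler's identity recovers
the function from them, and those of negative weight vanish because dilations contract `ℝⁿ` to the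
origin. Second, `exists_diffeomorph_of_homogeneous`: homogeneous coordinates near the origin of a
graded space are global, since `h_t` contracts every point into the chart and is invertible for `t ≠
0`.

A space of degree at most `k` is therefore `ℝⁿ` with a weighted dilation, and an equivariant map to
`ℝ[ε]/⟨ε^(k+1)⟩` is a sum of terms `P_j ε^j` with `P_j` a polynomial of weight `j ≤ k`. Hence the
functions `y_i ε^(w_i)` freely generate the dual up to weight `k` (`isFreeWeilGen_coordGen`).

The evaluation maps are isomorphisms because they match coordinates: `A → A**` carries free
generators to free generators of the same weights, and `V → V**` becomes the identity of `ℝⁿ` in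
homogeneous coordinates. Naturality and the triangle identity hold by definition, as all functors
act by precomposition. -/

namespace GradedDuality

open Filter Topology

/-! ## Homogeneous smooth functions on `ℝⁿ` are polynomials -/

/-- The dilation `(x_i) ↦ (t ^ w_i x_i)` of `ℝⁿ`. -/
noncomputable def dilation {n : ℕ} (w : Fin n → ℕ) (t : ℝ) : (Fin n → ℝ) →L[ℝ] (Fin n → ℝ) :=
  ContinuousLinearMap.pi fun i => t ^ w i • ContinuousLinearMap.proj i

section dilation

variable {n : ℕ} (w : Fin n → ℕ)

theorem dilation_apply (t : ℝ) (x : Fin n → ℝ) (i : Fin n) :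
    dilation w t x i = t ^ w i * x i := by
  simp [dilation]

theorem dilation_one (x : Fin n → ℝ) : dilation w 1 x = x := by
  ext i
  simp [dilation_apply]

theorem dilation_single (t : ℝ) (j : Fin n) :
    dilation w t (Pi.single j 1) = t ^ w j • Pi.single j 1 := by
  ext i
  rw [dilation_apply, Pi.smul_apply, smul_eq_mul]
  rcases eq_or_ne i j with rfl | h
  · rfl
  · simp [Pi.single_eq_of_ne h]

theorem tendsto_dilation (hw : ∀ i, 1 ≤ w i) (x : Fin n → ℝ) :
    Tendsto (fun t => dilation w t x) (𝓝[≠] 0) (𝓝 0) := by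
  refine tendsto_pi_nhds.2 fun i => ?_
  simp only [dilation_apply]
  have h : Continuous fun t : ℝ => t ^ w i * x i := by fun_prop
  have h0 := h.tendsto 0
  rw [zero_pow (Nat.one_le_iff_ne_zero.1 (hw i)), zero_mul] at h0
  exact h0.mono_left nhdsWithin_le_nhds

theorem hasDerivAt_dilation (x : Fin n → ℝ) :
    HasDerivAt (fun t => dilation w t x) (fun i => w i * x i) 1 := by
  refine hasDerivAt_pi.2 fun i => ?_
  simp only [dilation_apply]
  simpa using (hasDerivAt_pow (w i) (1 : ℝ)).mul_const (x i)

/-- The partial derivatives of a homogeneous function are homogeneous. -/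
theorem fderiv_dilation_single {f : (Fin n → ℝ) → ℝ} (hf : Differentiable ℝ f) {t c : ℝ}
    (hom : ∀ x, f (dilation w t x) = c * f x) (j : Fin n) (x : Fin n → ℝ) :
    t ^ w j * fderiv ℝ f (dilation w t x) (Pi.single j 1) =
      c * fderiv ℝ f x (Pi.single j 1) := by
  -- The composite of `f` with the dilation is differentiated twice: by the chain rule, and after
  -- replacing it by `c • f`.
  have h1 : HasFDerivAt (fun x => f (dilation w t x))
      ((fderiv ℝ f (dilation w t x)).comp (dilation w t)) x :=
    (hf _).hasFDerivAt.comp x (dilation w t).hasFDerivAt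
  have h2 : HasFDerivAt (fun x => f (dilation w t x)) (c • fderiv ℝ f x) x := by
    simp only [hom]
    exact (hf x).hasFDerivAt.const_mul c
  have h3 := congrArg (fun L => L (Pi.single j 1)) (h1.unique h2)
  simpa [dilation_single] using h3

/-- Euler's identity for homogeneous functions. -/
theorem euler_identity {f : (Fin n → ℝ) → ℝ} (hf : Differentiable ℝ f) {m : ℕ}
    (hom : ∀ t : ℝ, t ≠ 0 → ∀ x, f (dilation w t x) = t ^ m * f x) (x : Fin n → ℝ) :
    ∑ j, w j * x j * fderiv ℝ f x (Pi.single j 1) = m * f x := by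
  -- The curve `t ↦ f (dilation w t x)` is differentiated at `t = 1` in two ways. Homogeneity is
  -- known only for `t ≠ 0`, which suffices near `1`.
  have h1 : HasDerivAt (fun t => f (dilation w t x)) (fderiv ℝ f x fun i => w i * x i) 1 := by
    have h := (hf (dilation w 1 x)).hasFDerivAt.comp_hasDerivAt (1 : ℝ) (hasDerivAt_dilation w x)
    rwa [dilation_one] at h
  have h2 : HasDerivAt (fun t => f (dilation w t x)) (m * f x) 1 := by
    have h : HasDerivAt (fun t : ℝ => t ^ m * f x) (m * f x) 1 := by
      simpa using (hasDerivAt_pow m (1 : ℝ)).mul_const (f x)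
    refine h.congr_of_eventuallyEq ?_
    filter_upwards [isOpen_ne.mem_nhds (one_ne_zero (α := ℝ))] with t ht using hom t ht x
  rw [← h1.unique h2, ← ContinuousLinearMap.coe_coe, LinearMap.pi_apply_eq_sum_univ]
  refine Finset.sum_congr rfl fun j _ => ?_
  congr 2
  ext i
  simp [Pi.single_apply, eq_comm]

/-- A smooth function on `ℝⁿ` which is homogeneous of weight `m`, for positive weights of the
coordinates, is a weighted homogeneous polynomial. -/
theorem exists_polynomial_of_homogeneous (hw : ∀ i, 1 ≤ w i) (m : ℕ) (f : (Fin n → ℝ) → ℝ)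
    (hf : ContDiff ℝ ∞ f) (hom : ∀ t : ℝ, t ≠ 0 → ∀ x, f (dilation w t x) = t ^ m * f x) :
    ∃ P : MvPolynomial (Fin n) ℝ, P.IsWeightedHomogeneous w m ∧
      ∀ x, f x = MvPolynomial.eval x P := by
  induction m using Nat.strong_induction_on generalizing f with
  | _ m ih =>
    -- In weight `0` the function is constant along each orbit of dilations with `t ≠ 0`, and these
    -- orbits tend to the origin; continuity gives `f x = f 0`.
    rcases Nat.eq_zero_or_pos m with rfl | hm
    · refine ⟨MvPolynomial.C (f 0), MvPolynomial.isWeightedHomogeneous_C _ _, fun x => ?_⟩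
      rw [MvPolynomial.eval_C]
      have h1 := (hf.continuous.tendsto 0).comp (tendsto_dilation w hw x)
      refine tendsto_nhds_unique (tendsto_const_nhds.congr' ?_) h1
      filter_upwards [self_mem_nhdsWithin] with t ht
      rw [Function.comp_apply, hom t ht, pow_zero, one_mul]
    have hd : Differentiable ℝ f := hf.differentiable (by simp)
    have hg : ∀ j, ContDiff ℝ ∞ fun x => fderiv ℝ f x (Pi.single j 1) := fun j =>
      (hf.fderiv_right (m := ∞) (by simp)).clm_apply contDiff_const
    -- Weight is recorded for `X j * P`, not for `P`: this is what Euler's identity uses, and it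
    -- allows `P = 0` when `m - w j` would be negative.
    have hP : ∀ j, ∃ P : MvPolynomial (Fin n) ℝ,
        (MvPolynomial.X j * P).IsWeightedHomogeneous w m ∧
        ∀ x, fderiv ℝ f x (Pi.single j 1) = MvPolynomial.eval x P := by
      intro j
      rcases le_or_gt (w j) m with hj | hj
      · obtain ⟨P, hP, hP'⟩ := ih (m - w j) (by have := hw j; omega) _ (hg j) fun t ht x => by
          have h := fderiv_dilation_single w hd (hom t ht) j x
          rw [← Nat.add_sub_cancel' hj, pow_add, mul_assoc] at h
          exact mul_left_cancel₀ (pow_ne_zero _ ht) h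
        refine ⟨P, ?_, hP'⟩
        have h := (MvPolynomial.isWeightedHomogeneous_X ℝ w j).mul hP
        rwa [Nat.add_sub_cancel' hj] at h
      · refine ⟨0, by simpa using MvPolynomial.isWeightedHomogeneous_zero ℝ w m, fun x => ?_⟩
        rw [map_zero]
        -- For `w j > m` the partial derivative at `x` equals `t ^ (w j - m)` times its value at the
        -- dilated point, for every `t ≠ 0`; letting `t` tend to `0` makes it vanish.
        have h1 : Tendsto (fun t => t ^ (w j - m) *
            fderiv ℝ f (dilation w t x) (Pi.single j 1)) (𝓝[≠] 0)
            (𝓝 (0 * fderiv ℝ f 0 (Pi.single j 1))) := by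
          refine Tendsto.mul ?_ (((hg j).continuous.tendsto 0).comp (tendsto_dilation w hw x))
          have h := (continuous_pow (M := ℝ) (w j - m)).tendsto 0
          rw [zero_pow (by omega)] at h
          exact h.mono_left nhdsWithin_le_nhds
        rw [zero_mul] at h1
        refine tendsto_nhds_unique (tendsto_const_nhds.congr' ?_) h1
        filter_upwards [self_mem_nhdsWithin] with t ht
        have h := fderiv_dilation_single w hd (hom t ht) j x
        rw [← Nat.add_sub_cancel' hj.le, pow_add, mul_assoc] at h
        exact (mul_left_cancel₀ (pow_ne_zero _ ht) h).symm
    choose P hP hP' using hP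
    -- Euler's identity solved for `f`.
    refine ⟨(m : ℝ)⁻¹ • ∑ j, (w j : ℝ) • (MvPolynomial.X j * P j), ?_, fun x => ?_⟩
    · exact (MvPolynomial.weightedHomogeneousSubmodule ℝ w m).smul_mem _ <|
        (MvPolynomial.weightedHomogeneousSubmodule ℝ w m).sum_mem fun j _ =>
        (MvPolynomial.weightedHomogeneousSubmodule ℝ w m).smul_mem _ (hP j)
    · have hm' : (m : ℝ) ≠ 0 := by positivity
      rw [MvPolynomial.smul_eval, map_sum, eq_inv_mul_iff_mul_eq₀ hm',
        ← euler_identity w hd hom x]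
      refine Finset.sum_congr rfl fun j _ => ?_
      rw [MvPolynomial.smul_eval, map_mul, MvPolynomial.eval_X, ← hP', mul_assoc]

end dilation

/-! ## Graded spaces of degree at most `k` are globally dilation spaces -/

section globalCoord

variable {V : GradedSpace.{u}} {n : ℕ} {w : Fin n → ℕ} {y : V → EuclideanSpace ℝ (Fin n)}

theorem GradedSpace.h_inv_h (V : GradedSpace.{u}) {t : ℝ} (ht : t ≠ 0) (v : V) :
    V.h t⁻¹ (V.h t v) = v := by
  rw [← V.h_mul, inv_mul_cancel₀ ht, V.h_one]

theorem GradedSpace.contMDiff_h (V : GradedSpace.{u}) (t : ℝ) :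
    ContMDiff (𝓡 V.dim) (𝓡 V.dim) ∞ (V.h t) :=
  V.smooth_h.comp (contMDiff_const.prodMk contMDiff_id)

/-- The points `h t v` tend to the origin as `t` tends to `0`. -/
theorem GradedSpace.tendsto_h (V : GradedSpace.{u}) {o : V} (ho : ∀ v, V.h 0 v = o) (v : V) :
    Tendsto (fun t => V.h t v) (𝓝[≠] 0) (𝓝 o) := by
  have h : Continuous fun t => V.h t v :=
    V.smooth_h.continuous.comp (continuous_id.prodMk continuous_const)
  have h0 := h.tendsto 0
  rw [ho] at h0
  exact h0.mono_left nhdsWithin_le_nhds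

theorem coord_h_eq (hy : ∀ t v i, y (V.h t v) i = t ^ w i * y v i) (t : ℝ) (v : V) :
    y (V.h t v) = WithLp.toLp 2 (dilation w t (y v)) := by
  ext i
  exact (hy t v i).trans (dilation_apply w t (y v) i).symm

/-- A small `t ≠ 0` moves both points into the region around the origin where `y` is invertible.
Their coordinates still agree there, so the moved points coincide, and `h_t` can be undone. -/
theorem coord_injective {o : V} (ho : ∀ v, V.h 0 v = o)
    (hy : ∀ t v i, y (V.h t v) i = t ^ w i * y v i)
    (hl : IsLocalDiffeomorphAt (𝓡 V.dim) (𝓡 n) ∞ y o) : Function.Injective y := by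
  intro v v' h
  have hU := hl.localInverse.open_target.mem_nhds hl.localInverse_mem_target
  obtain ⟨t, ⟨ht, ht'⟩, ht0⟩ := (((V.tendsto_h ho v).eventually hU).and
    ((V.tendsto_h ho v').eventually hU)).and self_mem_nhdsWithin |>.exists
  rw [← V.h_inv_h ht0 v, ← V.h_inv_h ht0 v', ← hl.localInverse_left_inv ht,
    ← hl.localInverse_left_inv ht', coord_h_eq hy, coord_h_eq hy, h]

/-- Positive weights force `y o = 0`, so the domain of the local inverse is a neighbourhood of `0`,
and dilations contract `x` to `0`. -/
theorem exists_dilation_mem (hw : ∀ i, 1 ≤ w i) {o : V} (ho : ∀ v, V.h 0 v = o)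
    (hy : ∀ t v i, y (V.h t v) i = t ^ w i * y v i)
    (hl : IsLocalDiffeomorphAt (𝓡 V.dim) (𝓡 n) ∞ y o) (x : EuclideanSpace ℝ (Fin n)) :
    ∃ t : ℝ, t ≠ 0 ∧ WithLp.toLp 2 (dilation w t x) ∈ hl.localInverse.source := by
  have hy0 : y o = 0 := by
    ext i
    rw [← ho o, hy, zero_pow (Nat.one_le_iff_ne_zero.1 (hw i)), zero_mul]
    rfl
  have hU := hl.localInverse.open_source.mem_nhds hl.localInverse_mem_source
  rw [hy0] at hU
  have h := ((PiLp.continuous_toLp 2 fun _ : Fin n => ℝ).tendsto 0).comp (tendsto_dilation w hw x)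
  obtain ⟨t, ht, ht0⟩ := ((h.eventually hU).and self_mem_nhdsWithin).exists
  exact ⟨t, ht0, ht⟩

/-- This explicit preimage of `x` serves twice: for surjectivity of `y` and, with `t` kept fixed
near `x`, for smoothness of the inverse. -/
theorem coord_h_localInverse {o : V} (hy : ∀ t v i, y (V.h t v) i = t ^ w i * y v i)
    (hl : IsLocalDiffeomorphAt (𝓡 V.dim) (𝓡 n) ∞ y o) {t : ℝ} (ht : t ≠ 0)
    {x : EuclideanSpace ℝ (Fin n)}
    (hx : WithLp.toLp 2 (dilation w t x) ∈ hl.localInverse.source) :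
    y (V.h t⁻¹ (hl.localInverse (WithLp.toLp 2 (dilation w t x)))) = x := by
  ext i
  rw [hy, hl.localInverse_right_inv hx]
  change _ * dilation w t x i = _
  rw [dilation_apply, ← mul_assoc, ← mul_pow, inv_mul_cancel₀ ht, one_pow, one_mul]

/-- Homogeneous coordinates around the origin of a graded space are global coordinates. -/
theorem exists_diffeomorph_of_homogeneous (hw : ∀ i, 1 ≤ w i) {o : V} (ho : ∀ v, V.h 0 v = o)
    (hs : ContMDiff (𝓡 V.dim) (𝓡 n) ∞ y) (hy : ∀ t v i, y (V.h t v) i = t ^ w i * y v i)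
    (hl : IsLocalDiffeomorphAt (𝓡 V.dim) (𝓡 n) ∞ y o) :
    ∃ Φ : V ≃ₘ^∞⟮𝓡 V.dim, 𝓡 n⟯ EuclideanSpace ℝ (Fin n), ⇑Φ = y := by
  have hinj := coord_injective ho hy hl
  have hbij : Function.Bijective y := by
    refine ⟨hinj, fun x => ?_⟩
    obtain ⟨t, ht, hx⟩ := exists_dilation_mem hw ho hy hl x
    exact ⟨_, coord_h_localInverse hy hl ht hx⟩
  refine ⟨⟨Equiv.ofBijective y hbij, hs, fun x => ?_⟩, rfl⟩
  obtain ⟨t, ht, hx⟩ := exists_dilation_mem hw ho hy hl x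
  have hD : ContDiff ℝ ∞ fun x : EuclideanSpace ℝ (Fin n) =>
      (WithLp.toLp 2 (dilation w t x) : EuclideanSpace ℝ (Fin n)) := by
    refine contDiff_euclidean.2 fun i => ?_
    change ContDiff ℝ ∞ fun x : EuclideanSpace ℝ (Fin n) => dilation w t x i
    simp only [dilation_apply]
    fun_prop
  -- The scale `t` found for `x` works on a whole neighbourhood of `x`; there this smooth formula
  -- agrees with the inverse because `y` is injective.
  have hloc : ContMDiffAt (𝓡 n) (𝓡 V.dim) ∞ (fun x : EuclideanSpace ℝ (Fin n) =>
      V.h t⁻¹ (hl.localInverse (WithLp.toLp 2 (dilation w t x)))) x :=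
    (V.contMDiff_h t⁻¹).contMDiffAt.comp x
      ((hl.localInverse_contMDiffOn.contMDiffAt
        (hl.localInverse.open_source.mem_nhds hx)).comp x hD.contMDiff.contMDiffAt)
  refine hloc.congr_of_eventuallyEq ?_
  filter_upwards [(hl.localInverse.open_source.preimage hD.continuous).mem_nhds hx] with x' hx'
  apply hinj
  exact (Equiv.ofBijective_apply_symm_apply y hbij x').trans
    (coord_h_localInverse hy hl ht hx').symm

/-- A graded space of degree at most `k` has a global system of homogeneous coordinates. -/
theorem HasDegreeLE.exists_diffeomorph {k : ℕ} (hV : HasDegreeLE k V) :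
    ∃ (n : ℕ) (w : Fin n → ℕ) (Φ : V ≃ₘ^∞⟮𝓡 V.dim, 𝓡 n⟯ EuclideanSpace ℝ (Fin n)),
      (∀ i, 1 ≤ w i ∧ w i ≤ k) ∧ ∀ t v i, Φ (V.h t v) i = t ^ w i * Φ v i := by
  obtain ⟨o, ho⟩ := V.h_zero
  obtain ⟨n, w, y, hw, hs, hy, hl⟩ := hV o
  obtain ⟨Φ, rfl⟩ := exists_diffeomorph_of_homogeneous (fun i => (hw i).1) ho hs hy hl
  exact ⟨n, w, Φ, hw, hy⟩

end globalCoord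

/-! ## The dual of a graded space is a free graded Weil algebra -/

/-- Every monomial of weight `m` contributes exactly the factor `ε^m`, which can be taken out of the
sum. -/
theorem Trunc.aeval_smul_eps_pow {k n : ℕ} (w : Fin n → ℕ) (c : Fin n → ℝ) {m : ℕ}
    {P : MvPolynomial (Fin n) ℝ} (hP : P.IsWeightedHomogeneous w m) :
    MvPolynomial.aeval (fun i => c i • Trunc.eps k ^ w i) P =
      MvPolynomial.eval c P • Trunc.eps k ^ m := by
  rw [MvPolynomial.aeval_def, MvPolynomial.eval₂_eq', MvPolynomial.eval_eq', Finset.sum_smul]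
  refine Finset.sum_congr rfl fun d hd => ?_
  have hm : ∑ i, w i * d i = m := by
    rw [← hP (MvPolynomial.mem_support_iff.1 hd), Finsupp.weight_apply,
      Finsupp.sum_fintype _ _ (by simp)]
    simp [mul_comm]
  simp only [_root_.smul_pow, ← pow_mul]
  rw [Finset.prod_smul, Finset.prod_pow_eq_pow_sum, hm, ← Algebra.smul_def, smul_smul]

/-- `ε` divides `x`. The exponent does not depend on `x`, so pointwise nilpotency of a function
gives nilpotency in the dual. -/
theorem Trunc.pow_eq_zero_of_coeff {k : ℕ} {x : Trunc k} (hx : Trunc.coeff k 0 x = 0) :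
    x ^ (k + 1) = 0 := by
  obtain ⟨p, rfl⟩ := Trunc.mk_surjective k x
  rw [Trunc.coeff_mk (Nat.zero_le k)] at hx
  rw [← map_pow, Trunc.mk_eq_zero_iff]
  exact pow_dvd_pow_of_dvd (X_dvd_iff.2 hx) _

/-- The evaluation at a point of a graded space. -/
noncomputable def evalAt (k : ℕ) (V : GradedSpace.{u}) (v : V) : HomGr k (spaceDual k V) where
  toAlgHom := (Pi.evalAlgHom ℝ (fun _ : V => Trunc k) v).comp (homG k V).val
  map_gr _ _ hf := hf v

/-- As `h_0` sends every point to the origin, this makes the weight-zero part of `f` a constant,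
which is the scalar split off from `f` in the next lemma. -/
theorem coeff_zero_h_eq {k : ℕ} {V : GradedSpace.{u}} (f : homG k V) (v : V) :
    Trunc.coeff k 0 (f.1 (V.h 0 v)) = Trunc.coeff k 0 (f.1 v) := by
  rw [f.2.2, Trunc.coeff_h, pow_zero, one_mul]

theorem spaceDual_exists_sub_isNilpotent (k : ℕ) (V : GradedSpace.{u}) (f : spaceDual k V) :
    ∃ r : ℝ, IsNilpotent (f - algebraMap ℝ (spaceDual k V) r) := by
  obtain ⟨o, ho⟩ := V.h_zero
  refine ⟨Trunc.coeff k 0 (Subtype.val f o), k + 1, Subtype.ext (funext fun v => ?_)⟩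
  refine Trunc.pow_eq_zero_of_coeff
    (x := Subtype.val f v - algebraMap ℝ (Trunc k) (Trunc.coeff k 0 (Subtype.val f o))) ?_
  rw [map_sub, ← coeff_zero_h_eq f v, ho, Algebra.algebraMap_eq_smul_one, map_smul,
    ← pow_zero (Trunc.eps k), Trunc.coeff_eps_pow (Nat.zero_le k)]
  simp

theorem isLocalRing_of_exists_sub_isNilpotent {A : Type u} [CommRing A] [Algebra ℝ A]
    [Nontrivial A] (h : ∀ a : A, ∃ r : ℝ, IsNilpotent (a - algebraMap ℝ A r)) :
    IsLocalRing A := by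
  have key : ∀ (a : A) (r : ℝ), r ≠ 0 → IsNilpotent (a - algebraMap ℝ A r) → IsUnit a := by
    intro a r hr ha
    have h1 : IsUnit (algebraMap ℝ A r) := (isUnit_iff_ne_zero.2 hr).map _
    simpa using ha.isUnit_add_left_of_commute h1 (Commute.all _ _)
  -- A nonzero scalar plus a nilpotent is a unit; if the scalar part of `a` is `0`, that of `1 - a`
  -- is `1`.
  refine IsLocalRing.of_isUnit_or_isUnit_one_sub_self fun a => ?_
  obtain ⟨r, hr⟩ := h a
  by_cases h0 : r = 0
  · refine Or.inr (key _ 1 one_ne_zero ?_)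
    rw [h0, map_zero, sub_zero] at hr
    simpa using hr.neg
  · exact Or.inl (key a r h0 hr)

instance (k : ℕ) (V : GradedSpace.{u}) : Nontrivial (spaceDual k V) := by
  obtain ⟨o, -⟩ := V.h_zero
  refine ⟨0, 1, fun h => ?_⟩
  have h1 := congrArg (fun f => Trunc.coeff k 0 ((evalAt k V o).toAlgHom f)) h
  simp only [map_zero, map_one] at h1
  rw [← pow_zero (Trunc.eps k), Trunc.coeff_eps_pow (Nat.zero_le k)] at h1
  simp at h1

/-- The element `a` is a root of `(X - r)^N`. Together with finite generation as an algebra this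
yields finite dimension without counting monomials. -/
theorem isIntegral_of_exists_sub_isNilpotent {A : Type u} [CommRing A] [Algebra ℝ A]
    (h : ∀ a : A, ∃ r : ℝ, IsNilpotent (a - algebraMap ℝ A r)) : Algebra.IsIntegral ℝ A := by
  refine ⟨fun a => ?_⟩
  obtain ⟨r, N, hN⟩ := h a
  refine ⟨(X - C r) ^ N, (monic_X_sub_C r).pow N, ?_⟩
  simpa using hN

/-! ### Homogeneous coordinates as free Weil generators -/

section generators

variable {k : ℕ} {V : GradedSpace.{u}} {n : ℕ} {w : Fin n → ℕ}
  {Φ : V ≃ₘ^∞⟮𝓡 V.dim, 𝓡 n⟯ EuclideanSpace ℝ (Fin n)}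

/-- The elements `y_i ε ^ w_i` of the dual, for homogeneous global coordinates `y_i` of
weights `w_i`. -/
noncomputable def coordGen (k : ℕ) (hΦ : ∀ t v i, Φ (V.h t v) i = t ^ w i * Φ v i) (i : Fin n) :
    spaceDual k V :=
  ⟨fun v => Φ v i • Trunc.eps k ^ w i, fun l => by
    simp only [map_smul, smul_eq_mul]
    exact ((contMDiff_apply_euclidean i).comp Φ.contMDiff).mul contMDiff_const, fun t v => by
    beta_reduce
    rw [hΦ, map_smul, Trunc.h_eps_pow, smul_smul, mul_comm]⟩

theorem evalAt_coordGen (hΦ : ∀ t v i, Φ (V.h t v) i = t ^ w i * Φ v i) (v : V) (i : Fin n) :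
    (evalAt k V v).toAlgHom (coordGen k hΦ i) = Φ v i • Trunc.eps k ^ w i := rfl

theorem evalAt_aeval_coordGen (hΦ : ∀ t v i, Φ (V.h t v) i = t ^ w i * Φ v i) {m : ℕ}
    {P : MvPolynomial (Fin n) ℝ} (hP : P.IsWeightedHomogeneous w m) (v : V) :
    (evalAt k V v).toAlgHom (MvPolynomial.aeval (coordGen k hΦ) P) =
      MvPolynomial.eval (fun i => Φ v i) P • Trunc.eps k ^ m := by
  rw [← Trunc.aeval_smul_eps_pow w _ hP, ← AlgHom.comp_apply, MvPolynomial.comp_aeval]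
  rfl

theorem spaceDual_ext {f g : spaceDual k V}
    (h : ∀ v, (evalAt k V v).toAlgHom f = (evalAt k V v).toAlgHom g) : f = g :=
  Subtype.ext (funext h)

/-- The homogeneous functions on a graded space are polynomials in homogeneous global
coordinates. -/
theorem exists_polynomial_coeff (hΦ : ∀ t v i, Φ (V.h t v) i = t ^ w i * Φ v i)
    (hw : ∀ i, 1 ≤ w i) (f : homG k V) (j : ℕ) :
    ∃ P : MvPolynomial (Fin n) ℝ, P.IsWeightedHomogeneous w j ∧
      ∀ v, Trunc.coeff k j (f.1 v) = MvPolynomial.eval (fun i => Φ v i) P := by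
  have hsmooth : ContDiff ℝ ∞ fun x : Fin n → ℝ =>
      Trunc.coeff k j (f.1 (Φ.symm (WithLp.toLp 2 x))) :=
    ContMDiff.contDiff (((f.2.1 _).comp Φ.symm.contMDiff).comp
      (EuclideanSpace.equiv (Fin n) ℝ).symm.contDiff.contMDiff)
  obtain ⟨P, hP, hf⟩ := exists_polynomial_of_homogeneous w hw j _ hsmooth fun t _ x => by
    -- In the global coordinates `h_t` is the dilation, so equivariance of `f` says that its `j`-th
    -- coefficient has weight `j`.
    rw [← Trunc.coeff_h, ← f.2.2]
    refine congrArg (fun v => Trunc.coeff k j (f.1 v)) (Φ.injective ?_)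
    ext i
    change Φ (Φ.symm _) i = Φ (V.h t _) i
    rw [Φ.apply_symm_apply, hΦ, Φ.apply_symm_apply]
    exact dilation_apply w t x i
  refine ⟨P, hP, fun v => ?_⟩
  rw [← hf]
  exact congrArg (fun v => Trunc.coeff k j (f.1 v)) (Φ.symm_apply_apply v).symm

/-- The coefficient of `f` at `ε^j` is a polynomial `P j` of weight `j` in the coordinates.
Substituting the generators into `P j` restores the factor `ε^j`, so the sum of the `P j` represents
`f`. -/
theorem adjoin_coordGen (hΦ : ∀ t v i, Φ (V.h t v) i = t ^ w i * Φ v i)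
    (hw : ∀ i, 1 ≤ w i) : Algebra.adjoin ℝ (Set.range (coordGen k hΦ)) = ⊤ := by
  rw [Algebra.adjoin_range_eq_range_aeval, AlgHom.range_eq_top]
  intro f
  choose P hP hf using exists_polynomial_coeff hΦ hw f
  refine ⟨∑ j ∈ Finset.range (k + 1), P j, spaceDual_ext fun v => ?_⟩
  simp only [map_sum, evalAt_aeval_coordGen hΦ (hP _), ← hf]
  exact Trunc.sum_coeff _

theorem isFreeWeilGen_coordGen (hΦ : ∀ t v i, Φ (V.h t v) i = t ^ w i * Φ v i)
    (hw : ∀ i, 1 ≤ w i) : IsFreeWeilGen k (spaceDual k V) w (coordGen k hΦ) where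
  mem i v := Submodule.mem_span_singleton.2 ⟨Φ v i, rfl⟩
  adjoin_eq_top := adjoin_coordGen hΦ hw
  aeval_eq_zero_iff m P hP hP0 := by
    refine ⟨fun h => ?_, fun h => spaceDual_ext fun v => ?_⟩
    -- For `m ≤ k` the power `ε^m` has coefficient `1`, so `P` vanishes at the coordinates of every
    -- point of `V`. These fill `ℝⁿ`, hence `P = 0`.
    · by_contra! hm
      refine hP0 (MvPolynomial.funext fun x => ?_)
      have h1 := evalAt_aeval_coordGen (k := k) hΦ hP (Φ.symm (WithLp.toLp 2 x))
      rw [h, map_zero] at h1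
      have h2 := congrArg (Trunc.coeff k m) h1
      rw [map_smul, Trunc.coeff_eps_pow hm] at h2
      simpa using h2.symm
    · rw [evalAt_aeval_coordGen hΦ hP, Trunc.eps_pow_of_lt h, smul_zero, map_zero]

end generators

theorem isFreeGradedWeil_spaceDual (k : ℕ) (V : GradedSpace.{u}) (hV : HasDegreeLE k V) :
    IsFreeGradedWeil k (spaceDual k V) := by
  obtain ⟨n, w, Φ, hw, hΦ⟩ := hV.exists_diffeomorph
  have hgen := isFreeWeilGen_coordGen (k := k) hΦ fun i => (hw i).1
  have hnil := spaceDual_exists_sub_isNilpotent k V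
  have hint := isIntegral_of_exists_sub_isNilpotent hnil
  have hft : Algebra.FiniteType ℝ (spaceDual k V) :=
    ⟨(Subalgebra.fg_def).2 ⟨_, Set.finite_range _, hgen.adjoin_eq_top⟩⟩
  exact ⟨⟨Algebra.IsIntegral.finite, isLocalRing_of_exists_sub_isNilpotent hnil, hnil⟩,
    n, w, _, hgen⟩

/-! ## Bijective morphisms of graded algebras -/

section bijective

variable {k n : ℕ} {A B : GradedAlg.{u}} {w : Fin n → ℕ} {y : Fin n → A}

/-- The relations among free generators are determined by `k` and the weights alone, so `y` and its
image under `φ` satisfy the same ones. -/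
theorem IsFreeWeilGen.bijective (hy : IsFreeWeilGen k A w y) (φ : GradedAlgHom A B)
    (hφ : IsFreeWeilGen k B w fun i => φ (y i)) : Function.Bijective φ := by
  have haeval : ∀ p, φ (MvPolynomial.aeval (R := ℝ) y p) =
      MvPolynomial.aeval (R := ℝ) (fun i => φ (y i)) p := fun p => by
    rw [← AlgHom.comp_apply, MvPolynomial.comp_aeval]
  constructor
  · rw [injective_iff_map_eq_zero]
    intro a ha
    have hsurj : Function.Surjective (MvPolynomial.aeval (R := ℝ) y) := by
      rw [← AlgHom.range_eq_top, ← Algebra.adjoin_range_eq_range_aeval, hy.adjoin_eq_top]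
    obtain ⟨p, rfl⟩ := hsurj a
    -- Freeness only speaks of homogeneous polynomials. The components of `p` take values in
    -- different degrees of `B`, so each of them vanishes separately.
    obtain ⟨s, -, hs⟩ := exists_sum_weighted w p 0
    have hcomp : ∀ j, (MvPolynomial.weightedHomogeneousComponent w j p).IsWeightedHomogeneous w j :=
      fun j => MvPolynomial.weightedHomogeneousComponent_isWeightedHomogeneous _ _
    have h1 := eq_zero_of_sum_eq_zero B s
      (fun j => MvPolynomial.aeval (fun i => φ (y i))
        (MvPolynomial.weightedHomogeneousComponent w j p))
      (fun j => aeval_mem_of_isWeightedHomogeneous w _ hφ.mem j _ (hcomp j))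
      (by rw [← map_sum, hs, ← haeval, ha])
    rw [← hs, map_sum]
    refine Finset.sum_eq_zero fun j hj => ?_
    by_cases h0 : MvPolynomial.weightedHomogeneousComponent w j p = 0
    · rw [h0, map_zero]
    · exact (hy.aeval_eq_zero_iff j _ (hcomp j) h0).2
        ((hφ.aeval_eq_zero_iff j _ (hcomp j) h0).1 (h1 j hj))
  · rw [← AlgHom.range_eq_top, eq_top_iff, ← hφ.adjoin_eq_top]
    refine Algebra.adjoin_le ?_
    rintro _ ⟨i, rfl⟩
    exact ⟨y i, rfl⟩

theorem exists_sum_gr (A : GradedAlg.{u}) (a : A) (i : ℕ) :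
    ∃ (s : Finset ℕ) (x : ℕ → A), i ∈ s ∧ (∀ j, x j ∈ A.gr j) ∧ ∑ j ∈ s, x j = a := by
  classical
  obtain ⟨d, rfl⟩ := A.isInternal.2 a
  -- Inserting `i` makes the `i`-th component addressable even when it is zero.
  refine ⟨insert i d.support, fun j => d j, Finset.mem_insert_self _ _, fun j => (d j).2, ?_⟩
  rw [DirectSum.coeAddMonoidHom_eq_dfinsuppSum, DFinsupp.sum]
  refine (Finset.sum_subset (Finset.subset_insert _ _) fun j _ hj => ?_).symm
  rw [DFinsupp.notMem_support_iff.1 hj]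
  rfl

/-- An injective morphism of graded algebras reflects degrees. -/
theorem GradedAlgHom.mem_gr_of_map_mem (φ : GradedAlgHom A B) (hφ : Function.Injective φ) {i : ℕ}
    {a : A} (ha : φ a ∈ B.gr i) : a ∈ A.gr i := by
  obtain ⟨s, x, hi, hx, rfl⟩ := exists_sum_gr A a i
  -- Subtracting `φ a` in degree `i` makes the homogeneous terms sum to zero. The `i`-th term then
  -- gives `φ (x i) = φ a`, and injectivity identifies `a` with its `i`-th component.
  have h1 := eq_zero_of_sum_eq_zero B s
    (fun j => φ (x j) - if j = i then φ (∑ j ∈ s, x j) else 0)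
    (fun j => by
      refine (B.gr j).sub_mem (φ.map_gr j _ (hx j)) ?_
      split_ifs with hj
      · exact hj ▸ ha
      · exact Submodule.zero_mem _)
    (by rw [Finset.sum_sub_distrib, ← map_sum, Finset.sum_ite_eq' s i, if_pos hi, sub_self])
  have h2 := h1 i hi
  simp only [if_true] at h2
  rw [← hφ (sub_eq_zero.1 h2)]
  exact hx i

/-- A bijective morphism of graded algebras is an isomorphism. -/
noncomputable def GradedAlgHom.isoOfBijective (φ : GradedAlgHom A B)
    (hφ : Function.Bijective φ) : A ≅ B where
  hom := φ
  inv := ⟨(AlgEquiv.ofBijective φ.toAlgHom hφ).symm.toAlgHom, fun i b hb =>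
    φ.mem_gr_of_map_mem hφ.1 (by
      rwa [← (AlgEquiv.ofBijective φ.toAlgHom hφ).apply_symm_apply b] at hb)⟩
  hom_inv_id := GradedAlgHom.ext
    (AlgHom.ext (AlgEquiv.ofBijective φ.toAlgHom hφ).symm_apply_apply)
  inv_hom_id := GradedAlgHom.ext
    (AlgHom.ext (AlgEquiv.ofBijective φ.toAlgHom hφ).apply_symm_apply)

end bijective

/-! ## The evaluation isomorphisms -/

/-- The evaluation map `A → (A^*)^*`. -/
noncomputable def algEval {k : ℕ} {A : GradedAlg.{u}} (hA : IsFreeGradedWeil k A) :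
    GradedAlgHom A (spaceDual k (algDual hA)) where
  toAlgHom :=
    { toFun := fun a => ⟨fun ψ => GradedAlgHom.toAlgHom (B := model k) ψ a,
        smoothToTrunc_iff.2 (contMDiff_coeff_eval hA a), fun _ _ => rfl⟩
      map_one' := Subtype.ext (funext fun ψ => map_one (GradedAlgHom.toAlgHom (B := model k) ψ))
      map_mul' := fun a b =>
        Subtype.ext (funext fun ψ => map_mul (GradedAlgHom.toAlgHom (B := model k) ψ) a b)
      map_zero' := Subtype.ext (funext fun ψ => map_zero (GradedAlgHom.toAlgHom (B := model k) ψ))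
      map_add' := fun a b =>
        Subtype.ext (funext fun ψ => map_add (GradedAlgHom.toAlgHom (B := model k) ψ) a b)
      commutes' := fun r =>
        Subtype.ext (funext fun ψ => AlgHom.commutes (GradedAlgHom.toAlgHom (B := model k) ψ) r) }
  map_gr i a ha ψ := GradedAlgHom.map_gr (B := model k) ψ i a ha

/-- The global coordinates on the dual of an algebra as a diffeomorphism. -/
noncomputable def algCoordDiffeomorph {k : ℕ} {A : GradedAlg.{u}} (hA : IsFreeGradedWeil k A) :
    algDual hA ≃ₘ^∞⟮𝓡 (algDual hA).dim, 𝓡 (genNum hA)⟯ EuclideanSpace ℝ (Fin (genNum hA)) where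
  toEquiv := algCoord hA
  contMDiff_toFun := contMDiff_coord (algCoord hA)
  contMDiff_invFun := contMDiff_coord_symm (algCoord hA)

/-- Evaluation at the `i`-th generator is `ψ ↦ λ_i ε^(w_i)`, which is the coordinate generator of
the double dual; thus free generators go to free generators. -/
theorem algEval_bijective {k : ℕ} {A : GradedAlg.{u}} (hA : IsFreeGradedWeil k A) :
    Function.Bijective (algEval hA) := by
  refine (gen_free hA).bijective (algEval hA) ?_
  have hΦ : ∀ t v i, algCoordDiffeomorph hA ((algDual hA).h t v) i =
      t ^ genWt hA i * algCoordDiffeomorph hA v i := algCoord_act hA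
  convert isFreeWeilGen_coordGen (k := k) hΦ fun i => (genWt_mem hA i).1 using 2 with i
  exact spaceDual_ext fun ψ => homGr_apply_gen (gen_free hA) ψ i

/-- The evaluation map `V → (V^*)^*`. -/
noncomputable def spaceEval {k : ℕ} {V : GradedSpace.{u}}
    (hV : IsFreeGradedWeil k (spaceDual k V)) : GradedSpaceHom V (algDual hV) where
  toFun := evalAt k V
  smooth := by
    -- Smoothness is tested in the global chart of the dual, where the components are coefficients
    -- of elements of `homG k V` and hence smooth.
    have h1 : evalAt k V = (algCoord hV).symm ∘ fun v => algCoord hV (evalAt k V v) := by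
      funext v
      simp
    rw [h1]
    let := coordTop (algCoord hV)
    let := coordCharted (algCoord hV)
    refine ContMDiff.comp (I' := 𝓡 (genNum hV)) (contMDiff_coord_symm (algCoord hV))
      (contMDiff_euclidean_of fun i => ?_)
    exact (gen hV i).2.1 (Trunc.coeff k (genWt hV i))
  map_h t v := GradedAlgHom.ext (AlgHom.ext fun f => f.2.2 t v)

/-- In the coordinates on the double dual given by the `y_i ε^(w_i)`, evaluation at `v` has
coordinates `Φ v`, so the inverse is `Φ.symm` after these coordinates. The chart of `algDual` may
come from other generators, but `contMDiff_coeff_eval` makes these coordinates smooth as well. -/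
theorem exists_spaceEval_inverse {k : ℕ} {V : GradedSpace.{u}} (hV : HasDegreeLE k V)
    (hV' : IsFreeGradedWeil k (spaceDual k V)) :
    ∃ g : algDual hV' → V, ContMDiff (𝓡 (algDual hV').dim) (𝓡 V.dim) ∞ g ∧
      Function.LeftInverse g (spaceEval hV') ∧ Function.RightInverse g (spaceEval hV') := by
  obtain ⟨n, w, Φ, hw, hΦ⟩ := hV.exists_diffeomorph
  have hgen := isFreeWeilGen_coordGen (k := k) hΦ fun i => (hw i).1
  have hcoord : ∀ v, homGrCoord w (coordGen k hΦ) (evalAt k V v) = Φ v := by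
    intro v
    ext i
    change Trunc.coeff k (w i) ((evalAt k V v).toAlgHom (coordGen k hΦ i)) = _
    rw [evalAt_coordGen, map_smul, Trunc.coeff_eps_pow (hw i).2]
    simp
  refine ⟨fun ψ => Φ.symm (homGrCoord w (coordGen k hΦ) ψ), ?_, fun v => ?_, fun ψ => ?_⟩
  · exact Φ.symm.contMDiff.comp (contMDiff_euclidean_of fun i =>
      contMDiff_coeff_eval hV' (coordGen k hΦ i) (w i) (hw i).2)
  · exact (congrArg Φ.symm (hcoord v)).trans (Φ.symm_apply_apply v)
  · refine (homGrCoord_bijective hgen fun i => (hw i).2).1 ?_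
    exact (hcoord _).trans (Φ.apply_symm_apply _)

/-- A bijective morphism of graded spaces with a smooth inverse is an isomorphism. -/
def GradedSpaceHom.isoOfInverse {V W : GradedSpace.{u}} (f : GradedSpaceHom V W) (g : W → V)
    (hg : ContMDiff (𝓡 W.dim) (𝓡 V.dim) ∞ g) (hl : Function.LeftInverse g f)
    (hr : Function.RightInverse g f) : V ≅ W where
  hom := f
  inv := ⟨g, hg, fun t x => by
    conv_lhs => rw [← hr x, ← f.map_h, hl]⟩
  hom_inv_id := GradedSpaceHom.ext (funext hl)
  inv_hom_id := GradedSpaceHom.ext (funext hr)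

/-- The evaluation map as an isomorphism of graded spaces. -/
noncomputable def spaceEvalIso {k : ℕ} {V : GradedSpace.{u}} (hV : HasDegreeLE k V)
    (hV' : IsFreeGradedWeil k (spaceDual k V)) : V ≅ algDual hV' :=
  (spaceEval hV').isoOfInverse _ (exists_spaceEval_inverse hV hV').choose_spec.1
    (exists_spaceEval_inverse hV hV').choose_spec.2.1
    (exists_spaceEval_inverse hV hV').choose_spec.2.2

/-- The natural isomorphism `V ≅ (V^*)^*`. -/
noncomputable def spaceEvalNatIso (k : ℕ)
    (hk : ∀ V : GradedSpace.{u}, HasDegreeLE k V → IsFreeGradedWeil k (spaceDual k V)) :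
    𝟭 (GrSp.{u} k) ≅ spaceDualFunctorLE k hk ⋙ algDualFunctor k :=
  NatIso.ofComponents
    (fun V => ObjectProperty.isoMk _ (spaceEvalIso V.property (hk V.obj V.property)))
    (fun _ => rfl)

/-- The natural isomorphism `A ≅ (A^*)^*`. -/
noncomputable def algEvalNatIso (k : ℕ)
    (hk : ∀ V : GradedSpace.{u}, HasDegreeLE k V → IsFreeGradedWeil k (spaceDual k V)) :
    algDualFunctor k ⋙ spaceDualFunctorLE k hk ≅ 𝟭 (FGWA.{u} k)ᵒᵖ :=
  NatIso.ofComponents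
    -- Passing to the opposite category turns `A ≅ A**` into an isomorphism from `A**` to `A`, the
    -- direction of a counit.
    (fun A => (ObjectProperty.isoMk _
      ((algEval A.unop.property).isoOfBijective (algEval_bijective A.unop.property)) :
        A.unop ≅ ⟨spaceDual k (algDual A.unop.property),
          hk _ (algDual_hasDegreeLE A.unop.property)⟩).op)
    (fun _ => rfl)

end GradedDuality

/-! ### The adjoint equivalence -/

theorem mainTheorem9 (k : ℕ) :
    ∃ hk : ∀ V : GradedDuality.GradedSpace.{u}, GradedDuality.HasDegreeLE k V →
        GradedDuality.IsFreeGradedWeil k (GradedDuality.spaceDual k V),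
      (GradedDuality.spaceDualFunctorLE k hk).IsEquivalence ∧
      (GradedDuality.algDualFunctor.{u} k).IsEquivalence ∧
      ∃ (η : 𝟭 (GradedDuality.GrSp.{u} k) ≅
            GradedDuality.spaceDualFunctorLE k hk ⋙ GradedDuality.algDualFunctor k)
        (θ : GradedDuality.algDualFunctor k ⋙ GradedDuality.spaceDualFunctorLE k hk ≅
            𝟭 (GradedDuality.FGWA.{u} k)ᵒᵖ),
        (∀ (V : GradedDuality.GrSp.{u} k) (P : V.obj) (f : GradedDuality.homG k V.obj),
          GradedDuality.GradedAlgHom.toAlgHom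
            (GradedDuality.GradedSpaceHom.toFun (η.hom.app V).hom P) f = f.1 P) ∧
        (∀ (A : GradedDuality.FGWA.{u} k) (a : A.obj) (ψ : GradedDuality.HomGr k A.obj),
          Subtype.val (GradedDuality.GradedAlgHom.toAlgHom
            (θ.hom.app (Opposite.op A)).unop.hom a) ψ = ψ.toAlgHom a) ∧
        (∀ V : GradedDuality.GrSp.{u} k,
          (GradedDuality.spaceDualFunctorLE k hk).map (η.hom.app V) ≫
            θ.hom.app ((GradedDuality.spaceDualFunctorLE k hk).obj V) = 𝟙 _) := by
  have hk := GradedDuality.isFreeGradedWeil_spaceDual.{u} k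
  exact ⟨hk,
    (CategoryTheory.Equivalence.mk _ _ (GradedDuality.spaceEvalNatIso k hk)
      (GradedDuality.algEvalNatIso k hk)).isEquivalence_functor,
    (CategoryTheory.Equivalence.mk _ _ (GradedDuality.spaceEvalNatIso k hk)
      (GradedDuality.algEvalNatIso k hk)).isEquivalence_inverse,
    GradedDuality.spaceEvalNatIso k hk, GradedDuality.algEvalNatIso k hk,
    -- In the triangle identity an element `f` of the dual goes to evaluation at `f`, which
    -- precomposition with `P ↦ (g ↦ g P)` turns back into `P ↦ f P`.
    fun _ _ _ => rfl, fun _ _ _ => rfl, fun _ => rfl⟩
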